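/- Fix $d$, a probability measure $P_X$ on $\mathbb R^d$, and the logistic function $g(x,\beta)=e^{x^T\beta}/(1+e^{x^T\beta})$. On a probability space with probability $\mathbb P$, let $\beta_0$ be a random vector in $\mathbb R^d$ with $E(\|\beta_0\|^2)<\infty$, let $X_n$ and $Y_n$ ($n\ge 1$) be random variables with values in $\mathbb R^d$ and in $\{0,1\}$, and let $$\beta_n=\beta_{n-1}+\frac{1}{n\log 2}\,\bigl(Y_n-g(X_n,\beta_{n-1})\bigr)X_n\qquad(n\ge1).$$ Suppose that for every $n\ge 0$, every Borel set $A\subseteq\mathbb R^d$ and $y\in\{0,1\}$, almost surely, $$\mathbb P(X_{n+1}\in A,\,Y_{n+1}=y\mid \beta_0,X_1,Y_1,\dots,X_n,Y_n)=\int_A g(x,\beta_n)^y(1-g(x,\beta_n))^{1-y}\,P_X(dx),$$ that $P_X$ has bounded support, and that $P_X(S)<1$ for every proper linear subspace $S$ of $\mathbb R^d$. Then $\beta_n$ converges $\mathbb P$-a.s. to a random vector $\tilde\beta$ and, as $n\to\infty$: (i) $V_n=\frac1n\sum_{k=1}^n k^2(\beta_k-\beta_{k-1})(\beta_k-\beta_{k-1})^T$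 converges $\mathbb P$-a.s. to the random matrix $$U=(\log 2)^{-2}\int xx^T g(x,\tilde\beta)(1-g(x,\tilde\beta))\,P_X(dx);$$ (ii) $\mathbb P$-a.s., the (regular) conditional distribution of $\sqrt n\,V_n^{-1/2}(\tilde\beta-\beta_n)$ given $\beta_0,X_1,Y_1,\dots,X_n,Y_n$ converges weakly to the standard normal distribution on $\mathbb R^d$. Here $V_n^{-1/2}$ is the inverse of the positive semidefinite square root of $V_n$, and is set to $0$ where $V_n$ is singular. -/

import Mathlib

open MeasureTheory ProbabilityTheory Filter Topology
open scoped MatrixOrder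

noncomputable section

namespace OnlineLogistic

/-- The space `ℝ^d` of features and of parameters, with its Euclidean structure. -/
abbrev Vec (d : ℕ) : Type := EuclideanSpace ℝ (Fin d)

/-- The logistic function `g(x, b) = exp (xᵀ b) / (1 + exp (xᵀ b))`. -/
def g {d : ℕ} (x b : Vec d) : ℝ :=
  Real.exp (inner ℝ x b) / (1 + Real.exp (inner ℝ x b))

/-- The Bernoulli likelihood `g(x, b) ^ y * (1 - g(x, b)) ^ (1 - y)` of the type `y ∈ {0, 1}`. -/
def lik {d : ℕ} (x b : Vec d) (y : Fin 2) : ℝ :=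
  g x b ^ (y : ℕ) * (1 - g x b) ^ (1 - (y : ℕ))

variable {d : ℕ} {Ω : Type*}

/-- The iterates of online gradient descent for the cross entropy loss (with base-two logarithms)
and step size `1 / n`:
`β_n = β_{n-1} + (1 / (n log 2)) (Y_n - g(X_n, β_{n-1})) X_n`, started at `β_0 = b₀`.
The observations are `(X_1, Y_1), (X_2, Y_2), …`; the entries `X 0` and `Y 0` are never used. -/
def beta (b₀ : Ω → Vec d) (X : ℕ → Ω → Vec d) (Y : ℕ → Ω → Fin 2) : ℕ → Ω → Vec d
  | 0, ω => b₀ ω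
  | n + 1, ω =>
      beta b₀ X Y n ω +
        (1 / (((n + 1 : ℕ) : ℝ) * Real.log 2) *
          (((Y (n + 1) ω : ℕ) : ℝ) - g (X (n + 1) ω) (beta b₀ X Y n ω))) • X (n + 1) ω

/-- The history `(β_0, X_1, Y_1, …, X_n, Y_n)` as one random variable. -/
def hist (b₀ : Ω → Vec d) (X : ℕ → Ω → Vec d) (Y : ℕ → Ω → Fin 2) (n : ℕ) (ω : Ω) :
    Vec d × (Fin n → Vec d × Fin 2) :=
  (b₀ ω, fun i => (X ((i : ℕ) + 1) ω, Y ((i : ℕ) + 1) ω))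

/-- The σ-algebra generated by `β_0, X_1, Y_1, …, X_n, Y_n`. -/
abbrev histSigma (b₀ : Ω → Vec d) (X : ℕ → Ω → Vec d) (Y : ℕ → Ω → Fin 2) (n : ℕ) :
    MeasurableSpace Ω :=
  MeasurableSpace.comap (hist b₀ X Y n) inferInstance

/-- The predictive rule: for all `n ≥ 0`, all Borel sets `A` and `y ∈ {0, 1}`,
`ℙ(X_{n+1} ∈ A, Y_{n+1} = y | β_0, X_1, Y_1, …, X_n, Y_n)
  = ∫_A g(x, β_n)^y (1 - g(x, β_n))^(1-y) P_X(dx)` almost surely. -/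
def IsPredictiveRule [MeasurableSpace Ω] (P : Measure Ω) (PX : Measure (Vec d))
    (b₀ : Ω → Vec d) (X : ℕ → Ω → Vec d) (Y : ℕ → Ω → Fin 2) : Prop :=
  ∀ (n : ℕ) (A : Set (Vec d)), MeasurableSet A → ∀ y : Fin 2,
    P⟦{ω | X (n + 1) ω ∈ A ∧ Y (n + 1) ω = y} | histSigma b₀ X Y n⟧
      =ᵐ[P] fun ω => ∫ x in A, lik x (beta b₀ X Y n ω) y ∂PX

/-- `U(b) = (log 2)⁻² ∫ x xᵀ g(x, b) (1 - g(x, b)) P_X(dx)`, with the integral taken entrywise. -/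
def U (PX : Measure (Vec d)) (b : Vec d) : Matrix (Fin d) (Fin d) ℝ :=
  Matrix.of fun i j => (Real.log 2 ^ 2)⁻¹ * ∫ x, x i * x j * (g x b * (1 - g x b)) ∂PX

/-- `V_n = (1 / n) ∑_{k = 1}^n k² (β_k - β_{k-1}) (β_k - β_{k-1})ᵀ`. -/
def V (b₀ : Ω → Vec d) (X : ℕ → Ω → Vec d) (Y : ℕ → Ω → Fin 2) (n : ℕ) (ω : Ω) :
    Matrix (Fin d) (Fin d) ℝ :=
  (1 / (n : ℝ)) • ∑ k ∈ Finset.Icc 1 n, ((k : ℝ) ^ 2) •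
    Matrix.vecMulVec (fun i => beta b₀ X Y k ω i - beta b₀ X Y (k - 1) ω i)
      (fun i => beta b₀ X Y k ω i - beta b₀ X Y (k - 1) ω i)

/-- `M^(-1/2)`, the inverse of the positive semidefinite square root of a positive semidefinite
matrix `M`; it is the zero matrix where `M` is singular (unless the dimension is zero). -/
def invSqrt (M : Matrix (Fin d) (Fin d) ℝ) : Matrix (Fin d) (Fin d) ℝ :=
  (CFC.sqrt M)⁻¹

/-- The standardized error `√n V_n^(-1/2) (b - β_n)`, for a random vector `b`. -/
def stdError (b₀ : Ω → Vec d) (X : ℕ → Ω → Vec d) (Y : ℕ → Ω → Fin 2) (b : Ω → Vec d)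
    (n : ℕ) (ω : Ω) : Vec d :=
  Real.sqrt n •
    Matrix.toEuclideanCLM (𝕜 := ℝ) (invSqrt (V b₀ X Y n ω)) (b ω - beta b₀ X Y n ω)

/-- The (regular) conditional distribution of the random vector `Z` given
`β_0, X_1, Y_1, …, X_n, Y_n`, at the sample point `ω`. -/
def condLaw [MeasurableSpace Ω] (P : Measure Ω) [IsFiniteMeasure P]
    (b₀ : Ω → Vec d) (X : ℕ → Ω → Vec d) (Y : ℕ → Ω → Fin 2)
    (Z : Ω → Vec d) (n : ℕ) (ω : Ω) : ProbabilityMeasure (Vec d) :=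
  ⟨condDistrib Z (hist b₀ X Y n) P (hist b₀ X Y n ω), inferInstance⟩

end OnlineLogistic

end

namespace OnlineLogistic

variable {d : ℕ} {Ω : Type*}

/-! ### The logistic function and the likelihood -/

/-! Put s_{n+1} = (log 2)⁻¹ (Y_{n+1} - g(X_{n+1}, β_n)) X_{n+1} (`score`), so that β_{n+1} = β_n +
s_{n+1} / (n + 1). The predictive rule draws each label from the currently fitted model. Hence,
given the history, s_{n+1} has the law `scoreLaw PX β_n`, which is bounded and centred with second
moment matrix U(β_n) (`integral_next_score`, `integral_inner_scoreLaw`, `integral_mul_scoreLaw`). So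
β_n - β_0 is a martingale with increments of size at most a constant over n, and it converges almost
surely. Moreover V_n is the average of the matrices s_k s_kᵀ. It differs from the Cesàro mean of
U(β_{k-1}) by an average of bounded martingale differences, which vanishes by Kronecker's lemma, so
V_n → U(β̃).

For (ii), fix n and a bounded history-measurable direction T, and interpolate in m ≥ n by `interp`,
that is exp(i√n⟨T, β_m - β_n⟩) exp(-(n/m) Tᵀ U(β_n) T / 2). At m = n this is the Gaussian
characteristic function, and as m → ∞ it becomes exp(i√n⟨T, β̃ - β_n⟩). A Taylor expansion bounds
one step by n/m - n/(m+1) times an error of order 1/√n + ‖β_m - β_n‖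
(`norm_integral_exp_sub_exp_le`). The weights telescope to at most 1, and ‖β_m - β_n‖ has
conditional mean of order 1/√n, so the total error is of order 1/√n on every history event, in
proportion to its probability (`norm_setIntegral_exp_sub_le`).

Such a bound on all history events is a pointwise almost sure bound on conditional characteristic
functions. It is applied to T = V_n^(-1/2) t, truncated where it is large, and made uniform in t by
density (`ae_forall_norm_charFun_sub_le`). Nondegeneracy makes U(β̃) positive definite, so along
almost every ω the quadratic form Tᵀ U(β_n) T tends to ‖t‖², and Lévy's continuity theorem
concludes. -/

theorem g_eq_sigmoid (x b : Vec d) : g x b = Real.sigmoid (inner ℝ x b) := by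
  have := Real.exp_pos (inner ℝ x b)
  rw [g, Real.sigmoid_def, Real.exp_neg]
  field_simp
  ring

theorem g_pos (x b : Vec d) : 0 < g x b := g_eq_sigmoid x b ▸ Real.sigmoid_pos _

theorem g_lt_one (x b : Vec d) : g x b < 1 := g_eq_sigmoid x b ▸ Real.sigmoid_lt_one _

theorem continuous_g : Continuous fun p : Vec d × Vec d => g p.1 p.2 := by
  simp only [g_eq_sigmoid]
  fun_prop

theorem continuous_g_right (x : Vec d) : Continuous (g x) :=
  Continuous.comp (f := fun b => (x, b)) continuous_g (by fun_prop)

/-- With p, p' the two values of `g`, p(1 - p) - p'(1 - p') = (p - p')(1 - p - p'); the second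
factor is at most 1 in modulus and the sigmoid is 1-Lipschitz. -/
theorem abs_g_mul_sub_le (x b b' : Vec d) :
    |g x b * (1 - g x b) - g x b' * (1 - g x b')| ≤ ‖x‖ * ‖b - b'‖ := by
  have hlip : LipschitzWith 1 Real.sigmoid := by
    refine lipschitzWith_of_nnnorm_deriv_le _root_.differentiable_sigmoid fun s => ?_
    rw [Real.deriv_sigmoid, ← NNReal.coe_le_coe, coe_nnnorm, Real.norm_eq_abs, NNReal.coe_one,
      abs_le]
    have := Real.sigmoid_pos s
    have := Real.sigmoid_lt_one s
    constructor <;> nlinarith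
  have h1 : |g x b - g x b'| ≤ ‖x‖ * ‖b - b'‖ := by
    rw [g_eq_sigmoid, g_eq_sigmoid]
    have h := hlip.dist_le_mul (inner ℝ x b) (inner ℝ x b')
    rw [Real.dist_eq, Real.dist_eq, NNReal.coe_one, one_mul, ← inner_sub_right] at h
    exact h.trans (abs_real_inner_le_norm _ _)
  have h2 : |1 - g x b - g x b'| ≤ 1 := by
    rw [abs_le]
    constructor <;> linarith [g_pos x b, g_pos x b', g_lt_one x b, g_lt_one x b']
  calc |g x b * (1 - g x b) - g x b' * (1 - g x b')|
      = |g x b - g x b'| * |1 - g x b - g x b'| := by rw [← abs_mul]; ring_nf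
    _ ≤ ‖x‖ * ‖b - b'‖ * 1 := by gcongr
    _ = _ := mul_one _

theorem g_mul_pos (x b : Vec d) : 0 < g x b * (1 - g x b) :=
  mul_pos (g_pos x b) (sub_pos.2 (g_lt_one x b))

theorem g_mul_le_one (x b : Vec d) : g x b * (1 - g x b) ≤ 1 := by
  nlinarith [g_pos x b, g_lt_one x b]

@[simp] theorem lik_zero (x b : Vec d) : lik x b 0 = 1 - g x b := by simp [lik]

@[simp] theorem lik_one (x b : Vec d) : lik x b 1 = g x b := by simp [lik]

theorem lik_nonneg (x b : Vec d) (y : Fin 2) : 0 ≤ lik x b y := by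
  fin_cases y
  · simpa using (g_lt_one x b).le
  · simpa using (g_pos x b).le

theorem lik_le_one (x b : Vec d) (y : Fin 2) : lik x b y ≤ 1 := by
  fin_cases y
  · simpa using (g_pos x b).le
  · simpa using (g_lt_one x b).le

theorem continuous_lik (y : Fin 2) : Continuous fun p : Vec d × Vec d => lik p.1 p.2 y := by
  fin_cases y
  · simp only [Fin.zero_eta, lik_zero]
    exact continuous_const.sub continuous_g
  · simpa using continuous_g

/-- The score `(log 2)⁻¹ (y - g(x, b)) x` of one observation. -/
noncomputable def score (y : Fin 2) (x b : Vec d) : Vec d :=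
  ((((y : ℕ) : ℝ) - g x b) / Real.log 2) • x

theorem norm_score_le (y : Fin 2) (x b : Vec d) : ‖score y x b‖ ≤ ‖x‖ / Real.log 2 := by
  have hl : 0 < Real.log 2 := Real.log_pos one_lt_two
  have h : |((y : ℕ) : ℝ) - g x b| ≤ 1 := by
    have := g_pos x b
    have := g_lt_one x b
    fin_cases y <;> simp only [abs_le] <;> norm_num <;> constructor <;> linarith
  rw [score, norm_smul, norm_div, Real.norm_eq_abs, Real.norm_eq_abs, abs_of_pos hl, div_mul_eq_mul_div]
  gcongr
  exact mul_le_of_le_one_left (norm_nonneg _) h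

theorem measurable_coe_fin {α : Type*} {m : MeasurableSpace α} {k : ℕ} {y : α → Fin k}
    (hy : Measurable y) : Measurable fun a => ((y a : ℕ) : ℝ) :=
  (measurable_of_countable fun i : Fin k => ((i : ℕ) : ℝ)).comp hy

theorem measurable_g {α : Type*} {m : MeasurableSpace α} {x b : α → Vec d}
    (hx : Measurable x) (hb : Measurable b) : Measurable fun a => g (x a) (b a) :=
  Measurable.comp (f := fun a => (x a, b a)) continuous_g.measurable (hx.prodMk hb)

theorem measurable_lik {α : Type*} {m : MeasurableSpace α} {x b : α → Vec d} (y : Fin 2)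
    (hx : Measurable x) (hb : Measurable b) : Measurable fun a => lik (x a) (b a) y :=
  Measurable.comp (f := fun a => (x a, b a)) (continuous_lik y).measurable (hx.prodMk hb)

theorem measurable_score {α : Type*} {m : MeasurableSpace α} {y : α → Fin 2}
    {x b : α → Vec d} (hy : Measurable y) (hx : Measurable x) (hb : Measurable b) :
    Measurable fun a => score (y a) (x a) (b a) := by
  have h : Measurable fun a => ((((y a : ℕ) : ℝ) - g (x a) (b a)) / Real.log 2) • x a :=
    (((measurable_coe_fin hy).sub (measurable_g hx hb)).div_const _).smul hx
  exact h

/-! ### The stochastic model -/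

/-- The observations follow the predictive rule, and the features are bounded by `C`. -/
structure IsOnlineModel [MeasurableSpace Ω] (P : Measure Ω) (PX : Measure (Vec d))
    (b₀ : Ω → Vec d) (X : ℕ → Ω → Vec d) (Y : ℕ → Ω → Fin 2) (C : ℝ) : Prop where
  meas_init : Measurable b₀
  meas_feature : ∀ n, 1 ≤ n → Measurable (X n)
  meas_label : ∀ n, 1 ≤ n → Measurable (Y n)
  rule : IsPredictiveRule P PX b₀ X Y
  bound_nonneg : 0 ≤ C
  feature_le : ∀ᵐ x ∂PX, ‖x‖ ≤ C

/-- Separates the vanishing step size from the score, which is a bounded martingale difference. -/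
theorem beta_succ (b₀ : Ω → Vec d) (X : ℕ → Ω → Vec d) (Y : ℕ → Ω → Fin 2) (n : ℕ) (ω : Ω) :
    beta b₀ X Y (n + 1) ω = beta b₀ X Y n ω +
      (1 / ((n : ℝ) + 1)) • score (Y (n + 1) ω) (X (n + 1) ω) (beta b₀ X Y n ω) := by
  rw [beta, score, smul_smul]
  congr 2
  push_cast
  rw [div_mul_div_comm, one_mul, one_div_mul_eq_div]

section History

variable (b₀ : Ω → Vec d) (X : ℕ → Ω → Vec d) (Y : ℕ → Ω → Fin 2)

theorem measurable_histSigma_init (n : ℕ) : Measurable[histSigma b₀ X Y n] b₀ :=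
  measurable_fst.comp (comap_measurable (hist b₀ X Y n))

theorem measurable_histSigma_obs {n k : ℕ} (h : k < n) :
    Measurable[histSigma b₀ X Y n] fun ω => (X (k + 1) ω, Y (k + 1) ω) :=
  ((measurable_pi_apply (⟨k, h⟩ : Fin n)).comp measurable_snd).comp
    (comap_measurable (hist b₀ X Y n))

theorem measurable_histSigma_feature {n k : ℕ} (h : k < n) :
    Measurable[histSigma b₀ X Y n] (X (k + 1)) :=
  measurable_fst.comp (measurable_histSigma_obs b₀ X Y h)

theorem measurable_histSigma_label {n k : ℕ} (h : k < n) :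
    Measurable[histSigma b₀ X Y n] (Y (k + 1)) :=
  measurable_snd.comp (measurable_histSigma_obs b₀ X Y h)

theorem histSigma_mono : Monotone (histSigma b₀ X Y) := by
  intro n m h
  have : Measurable[histSigma b₀ X Y m] (hist b₀ X Y n) :=
    (measurable_histSigma_init b₀ X Y m).prodMk <|
      @measurable_pi_lambda _ _ _ (histSigma b₀ X Y m) _ _ fun i =>
        measurable_histSigma_obs b₀ X Y (i.2.trans_le h)
  exact this.comap_le

theorem measurable_histSigma_score {n : ℕ}
    (hβ : Measurable[histSigma b₀ X Y n] (beta b₀ X Y n)) :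
    Measurable[histSigma b₀ X Y (n + 1)]
      fun ω => score (Y (n + 1) ω) (X (n + 1) ω) (beta b₀ X Y n ω) :=
  measurable_score (measurable_histSigma_label b₀ X Y n.lt_succ_self)
    (measurable_histSigma_feature b₀ X Y n.lt_succ_self)
    (hβ.mono (histSigma_mono b₀ X Y n.le_succ) le_rfl)

theorem measurable_histSigma_beta (n : ℕ) : Measurable[histSigma b₀ X Y n] (beta b₀ X Y n) := by
  induction n with
  | zero => exact measurable_histSigma_init b₀ X Y 0
  | succ n ih =>
    have : beta b₀ X Y (n + 1) = fun ω => beta b₀ X Y n ω +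
      (1 / ((n : ℝ) + 1)) • score (Y (n + 1) ω) (X (n + 1) ω) (beta b₀ X Y n ω) :=
      funext fun ω => beta_succ b₀ X Y n ω
    rw [this]
    exact (ih.mono (histSigma_mono b₀ X Y n.le_succ) le_rfl).add
      ((measurable_histSigma_score b₀ X Y ih).const_smul (1 / ((n : ℝ) + 1)))

theorem measurable_histSigma_beta_le {n m : ℕ} (h : n ≤ m) :
    Measurable[histSigma b₀ X Y m] (beta b₀ X Y n) :=
  (measurable_histSigma_beta b₀ X Y n).mono (histSigma_mono b₀ X Y h) le_rfl

end History

namespace IsOnlineModel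

variable [MeasurableSpace Ω] {P : Measure Ω} {PX : Measure (Vec d)} {b₀ : Ω → Vec d} {X : ℕ → Ω → Vec d} {Y : ℕ → Ω → Fin 2} {C : ℝ}

theorem measurable_hist (hM : IsOnlineModel P PX b₀ X Y C) (n : ℕ) :
    Measurable (hist b₀ X Y n) :=
  hM.meas_init.prodMk <| measurable_pi_lambda _ fun _ =>
    (hM.meas_feature _ (Nat.le_add_left 1 _)).prodMk (hM.meas_label _ (Nat.le_add_left 1 _))

theorem histSigma_le (hM : IsOnlineModel P PX b₀ X Y C) (n : ℕ) :
    histSigma b₀ X Y n ≤ ‹MeasurableSpace Ω› :=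
  (hM.measurable_hist n).comap_le

theorem measurable_beta (hM : IsOnlineModel P PX b₀ X Y C) (n : ℕ) :
    Measurable (beta b₀ X Y n) :=
  (measurable_histSigma_beta b₀ X Y n).mono (hM.histSigma_le n) le_rfl

end IsOnlineModel

/-! ### The law of the score under the predictive rule -/

/-- The law of the score `score y x b` when `x` has law `PX` and `y` has conditional
probability `lik x b y` given `x`. -/
noncomputable def scoreLaw (PX : Measure (Vec d)) (b : Vec d) : Measure (Vec d) :=
  ∑ y : Fin 2, (PX.withDensity fun x => ENNReal.ofReal (lik x b y)).map fun x => score y x b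

theorem measurable_ofReal_lik (b : Vec d) (y : Fin 2) :
    Measurable fun x => ENNReal.ofReal (lik x b y) :=
  (measurable_lik y measurable_id measurable_const).ennreal_ofReal

theorem measurable_score_left (b : Vec d) (y : Fin 2) : Measurable fun x => score y x b :=
  measurable_score measurable_const measurable_id measurable_const

theorem log_two_pos : 0 < Real.log 2 := Real.log_pos one_lt_two

section ScoreLaw

variable {PX : Measure (Vec d)} [IsProbabilityMeasure PX] {C : ℝ}

instance isProbabilityMeasure_scoreLaw (b : Vec d) : IsProbabilityMeasure (scoreLaw PX b) := by
  constructor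
  rw [scoreLaw, Measure.finsetSum_apply]
  simp_rw [Measure.map_apply (measurable_score_left b _) MeasurableSet.univ, Set.preimage_univ,
    withDensity_apply _ MeasurableSet.univ, Measure.restrict_univ]
  rw [← lintegral_finsetSum _ fun y _ => measurable_ofReal_lik b y]
  have : ∀ x, ∑ y : Fin 2, ENNReal.ofReal (lik x b y) = 1 := fun x => by
    rw [← ENNReal.ofReal_sum_of_nonneg fun y _ => lik_nonneg x b y]
    simp
  simp [this]

omit [IsProbabilityMeasure PX] in
theorem ae_norm_le_scoreLaw (hC : ∀ᵐ x ∂PX, ‖x‖ ≤ C) (b : Vec d) :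
    ∀ᵐ v ∂scoreLaw PX b, ‖v‖ ≤ C / Real.log 2 := by
  suffices h : ∀ y : Fin 2, ∀ᵐ v ∂(PX.withDensity fun x => ENNReal.ofReal (lik x b y)).map
      fun x => score y x b, ‖v‖ ≤ C / Real.log 2 by
    rw [scoreLaw, Fin.sum_univ_two, ae_add_measure_iff]
    exact ⟨h 0, h 1⟩
  intro y
  rw [ae_map_iff (measurable_score_left b y).aemeasurable
    (measurableSet_le measurable_norm measurable_const)]
  refine (withDensity_absolutelyContinuous _ _).ae_le ?_
  filter_upwards [hC] with x hx
  have := log_two_pos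
  exact (norm_score_le y x b).trans (by gcongr)

variable {E : Type*} [NormedAddCommGroup E]

theorem integrable_scoreLaw (hC : ∀ᵐ x ∂PX, ‖x‖ ≤ C) (b : Vec d) {φ : Vec d → E} {K : ℝ}
    (hφ : StronglyMeasurable φ) (hK : ∀ v, ‖v‖ ≤ C / Real.log 2 → ‖φ v‖ ≤ K) :
    Integrable φ (scoreLaw PX b) :=
  Integrable.of_bound hφ.aestronglyMeasurable K
    ((ae_norm_le_scoreLaw hC b).mono hK)

theorem integral_scoreLaw [NormedSpace ℝ E] (hC : ∀ᵐ x ∂PX, ‖x‖ ≤ C) (b : Vec d) {φ : Vec d → E} {K : ℝ}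
    (hφ : StronglyMeasurable φ) (hK : ∀ v, ‖v‖ ≤ C / Real.log 2 → ‖φ v‖ ≤ K) :
    ∫ v, φ v ∂scoreLaw PX b = ∑ y : Fin 2, ∫ x, lik x b y • φ (score y x b) ∂PX := by
  have hi := integrable_scoreLaw hC b hφ hK
  rw [scoreLaw, integrable_finsetSum_measure] at hi
  rw [scoreLaw, integral_finsetSum_measure hi]
  refine Finset.sum_congr rfl fun y _ => ?_
  rw [integral_map (measurable_score_left b y).aemeasurable hφ.aestronglyMeasurable,
    integral_withDensity_eq_integral_toReal_smul (measurable_ofReal_lik b y)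
      (by simp)]
  simp_rw [ENNReal.toReal_ofReal (lik_nonneg _ b y)]

theorem integral_scoreLaw_real (hC : ∀ᵐ x ∂PX, ‖x‖ ≤ C) (b : Vec d) {φ : Vec d → ℝ} {K : ℝ}
    (hφ : StronglyMeasurable φ) (hK : ∀ v, ‖v‖ ≤ C / Real.log 2 → |φ v| ≤ K) :
    ∫ v, φ v ∂scoreLaw PX b =
      ∫ x, ((1 - g x b) * φ (score 0 x b) + g x b * φ (score 1 x b)) ∂PX := by
  have hi : ∀ y, Integrable (fun x => lik x b y * φ (score y x b)) PX := fun y => by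
    refine Integrable.of_bound (C := K) (((measurable_lik y measurable_id measurable_const).mul
      (hφ.measurable.comp (measurable_score_left b y))).aestronglyMeasurable) ?_
    filter_upwards [hC] with x hx
    have h0 := log_two_pos
    have h1 : |φ (score y x b)| ≤ K := hK _ ((norm_score_le y x b).trans (by gcongr))
    rw [norm_mul, Real.norm_eq_abs, Real.norm_eq_abs, abs_of_nonneg (lik_nonneg x b y)]
    exact (mul_le_of_le_one_left (abs_nonneg _) (lik_le_one x b y)).trans h1
  have h0 := hi 0
  have h1 := hi 1
  simp only [lik_zero, lik_one] at h0 h1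
  rw [integral_scoreLaw hC b hφ hK, Fin.sum_univ_two, integral_add h0 h1]
  simp

theorem abs_inner_le_of_norm_le {t v : Vec d} {K : ℝ} (hv : ‖v‖ ≤ K) :
    |inner ℝ t v| ≤ ‖t‖ * K :=
  (abs_real_inner_le_norm t v).trans (by gcongr)

/-- Already for fixed x the mean over the label vanishes: (1 - g)(-g) + g(1 - g) = 0. -/
theorem integral_inner_scoreLaw (hC : ∀ᵐ x ∂PX, ‖x‖ ≤ C) (b t : Vec d) :
    ∫ v, inner ℝ t v ∂scoreLaw PX b = 0 := by
  rw [integral_scoreLaw_real hC b (by fun_prop) fun v hv => abs_inner_le_of_norm_le hv]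
  simp only [score, inner_smul_right]
  rw [← integral_zero (Vec d) ℝ (μ := PX)]
  congr 1 with x
  have h1 := log_two_pos.ne'
  simp
  ring

theorem abs_apply_le_norm (v : Vec d) (i : Fin d) : |v i| ≤ ‖v‖ := PiLp.norm_apply_le v i

theorem abs_apply_mul_apply_le {v : Vec d} {K : ℝ} (hv : ‖v‖ ≤ K) (i j : Fin d) :
    |v i * v j| ≤ K * K := by
  rw [abs_mul]
  have := (abs_apply_le_norm v i).trans hv
  have := (abs_apply_le_norm v j).trans hv
  have := (norm_nonneg v).trans hv
  gcongr

theorem integral_apply_scoreLaw (hC : ∀ᵐ x ∂PX, ‖x‖ ≤ C) (b : Vec d) (i : Fin d) :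
    ∫ v, v i ∂scoreLaw PX b = 0 := by
  have := integral_inner_scoreLaw hC b (EuclideanSpace.single i (1 : ℝ))
  simpa [EuclideanSpace.inner_single_left] using this

/-- For fixed x, the mean over the label rests on (1 - g)g² + g(1 - g)² = g(1 - g). -/
theorem integral_mul_scoreLaw (hC : ∀ᵐ x ∂PX, ‖x‖ ≤ C) (b : Vec d) (i j : Fin d) :
    ∫ v, v i * v j ∂scoreLaw PX b = U PX b i j := by
  rw [integral_scoreLaw_real hC b
    (by fun_prop) fun v hv => abs_apply_mul_apply_le hv i j, U, Matrix.of_apply,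
    ← integral_const_mul]
  congr 1 with x
  have h1 := log_two_pos.ne'
  simp only [score, PiLp.smul_apply, smul_eq_mul]
  simp
  field_simp
  ring

/-- The quadratic form `tᵀ U(b) t`. -/
noncomputable def fisher (PX : Measure (Vec d)) (b t : Vec d) : ℝ :=
  (Real.log 2 ^ 2)⁻¹ * ∫ x, inner ℝ t x ^ 2 * (g x b * (1 - g x b)) ∂PX

theorem integral_inner_sq_scoreLaw (hC : ∀ᵐ x ∂PX, ‖x‖ ≤ C) (b t : Vec d) :
    ∫ v, inner ℝ t v ^ 2 ∂scoreLaw PX b = fisher PX b t := by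
  rw [integral_scoreLaw_real (K := (‖t‖ * (C / Real.log 2)) ^ 2) hC b
    (by fun_prop) ?_, fisher, ← integral_const_mul]
  · congr 1 with x
    have h1 := log_two_pos.ne'
    simp only [score, inner_smul_right]
    simp
    field_simp
    ring
  · intro v hv
    rw [abs_pow]
    gcongr
    exact abs_inner_le_of_norm_le hv

omit [IsProbabilityMeasure PX] in
theorem fisher_nonneg (b t : Vec d) : 0 ≤ fisher PX b t :=
  mul_nonneg (by positivity) <| integral_nonneg fun x =>
    mul_nonneg (sq_nonneg _) (g_mul_pos x b).le

theorem integrable_fisher (hC : ∀ᵐ x ∂PX, ‖x‖ ≤ C) (b t : Vec d) :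
    Integrable (fun x => inner ℝ t x ^ 2 * (g x b * (1 - g x b))) PX := by
  have hg := measurable_g (measurable_id (α := Vec d)) (measurable_const (a := b))
  refine Integrable.of_bound (C := (‖t‖ * C) ^ 2)
    ((Measurable.mul (by fun_prop) (hg.mul (measurable_const.sub hg))).aestronglyMeasurable) ?_
  filter_upwards [hC] with x hx
  rw [norm_mul, Real.norm_eq_abs, Real.norm_eq_abs, abs_of_pos (g_mul_pos x b), abs_pow]
  refine (mul_le_of_le_one_right (by positivity) (g_mul_le_one x b)).trans ?_
  gcongr
  exact abs_inner_le_of_norm_le hx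

theorem fisher_le (hC : ∀ᵐ x ∂PX, ‖x‖ ≤ C) (b t : Vec d) :
    fisher PX b t ≤ ‖t‖ ^ 2 * (C / Real.log 2) ^ 2 := by
  rw [← integral_inner_sq_scoreLaw hC]
  have h : ∀ᵐ v ∂scoreLaw PX b, ‖inner ℝ t v ^ 2‖ ≤ ‖t‖ ^ 2 * (C / Real.log 2) ^ 2 := by
    filter_upwards [ae_norm_le_scoreLaw hC b] with v hv
    rw [norm_pow, Real.norm_eq_abs, ← mul_pow]
    gcongr
    exact abs_inner_le_of_norm_le hv
  refine (Real.le_norm_self _).trans ((norm_integral_le_of_norm_le_const h).trans_eq ?_)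
  simp

theorem abs_fisher_sub_le (hC : ∀ᵐ x ∂PX, ‖x‖ ≤ C) (b b' t : Vec d) :
    |fisher PX b t - fisher PX b' t| ≤
      (Real.log 2 ^ 2)⁻¹ * C ^ 3 * ‖t‖ ^ 2 * ‖b - b'‖ := by
  rw [fisher, fisher, ← mul_sub,
    ← integral_sub (integrable_fisher hC b t) (integrable_fisher hC b' t), abs_mul,
    abs_of_nonneg (by positivity), mul_assoc, mul_assoc]
  gcongr
  have h : ∀ᵐ x ∂PX, ‖inner ℝ t x ^ 2 * (g x b * (1 - g x b)) -
      inner ℝ t x ^ 2 * (g x b' * (1 - g x b'))‖ ≤ C ^ 3 * (‖t‖ ^ 2 * ‖b - b'‖) := by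
    filter_upwards [hC] with x hx
    have hC0 : 0 ≤ C := (norm_nonneg x).trans hx
    rw [← mul_sub, norm_mul, Real.norm_eq_abs, Real.norm_eq_abs, abs_pow]
    calc |inner ℝ t x| ^ 2 * |g x b * (1 - g x b) - g x b' * (1 - g x b')|
        ≤ (‖t‖ * C) ^ 2 * (C * ‖b - b'‖) := by
          gcongr
          · exact abs_inner_le_of_norm_le hx
          · exact (abs_g_mul_sub_le x b b').trans (by gcongr)
      _ = _ := by ring
  refine (norm_integral_le_of_norm_le_const h).trans_eq ?_
  simp

theorem continuous_U (hC : ∀ᵐ x ∂PX, ‖x‖ ≤ C) : Continuous (U PX) := by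
  refine continuous_matrix fun i j => ?_
  simp only [U, Matrix.of_apply]
  refine continuous_const.mul (continuous_of_dominated (bound := fun _ => C * C) ?_ ?_
    (integrable_const _) ?_)
  · intro b
    have hg := measurable_g (measurable_id (α := Vec d)) (measurable_const (a := b))
    exact (Measurable.mul (by fun_prop) (hg.mul (measurable_const.sub hg))).aestronglyMeasurable
  · intro b
    filter_upwards [hC] with x hx
    rw [norm_mul, Real.norm_eq_abs, Real.norm_eq_abs, abs_of_pos (g_mul_pos x b)]
    exact (mul_le_of_le_one_right (by positivity) (g_mul_le_one x b)).trans
      (abs_apply_mul_apply_le hx i j)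
  · refine ae_of_all _ fun x => continuous_const.mul ?_
    exact (continuous_g_right x).mul (continuous_const.sub (continuous_g_right x))

/-- Both sides are the second moment of ⟨t, v⟩ under the score law, expanded in coordinates. -/
theorem inner_toEuclideanCLM_U (hC : ∀ᵐ x ∂PX, ‖x‖ ≤ C) (b t : Vec d) :
    inner ℝ t (Matrix.toEuclideanCLM (𝕜 := ℝ) (U PX b) t) = fisher PX b t := by
  rw [← integral_inner_sq_scoreLaw hC, PiLp.inner_apply]
  have hi : ∀ i j, Integrable (fun v : Vec d => v i * v j) (scoreLaw PX b) := fun i j =>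
    integrable_scoreLaw hC b (by fun_prop)
      fun v hv => abs_apply_mul_apply_le hv i j
  have h : ∀ v : Vec d, inner ℝ t v ^ 2 = ∑ i, ∑ j, t i * t j * (v i * v j) := fun v => by
    rw [PiLp.inner_apply, sq, Finset.sum_mul_sum]
    refine Finset.sum_congr rfl fun i _ => Finset.sum_congr rfl fun j _ => ?_
    simp
    ring
  simp_rw [h]
  rw [integral_finsetSum _ fun i _ => integrable_finsetSum _ fun j _ => (hi i j).const_mul _]
  refine Finset.sum_congr rfl fun i _ => ?_
  rw [integral_finsetSum _ fun j _ => (hi i j).const_mul _]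
  simp_rw [integral_const_mul, integral_mul_scoreLaw hC]
  simp only [Matrix.ofLp_toEuclideanCLM, Matrix.mulVec, dotProduct]
  simp only [RCLike.inner_apply, conj_trivial, Finset.sum_mul]
  exact Finset.sum_congr rfl fun j _ => by ring

/-- Second order expansion of the characteristic function of the score. -/
theorem norm_integral_exp_scoreLaw_sub_le (hC : ∀ᵐ x ∂PX, ‖x‖ ≤ C) (b t : Vec d) {M : ℝ}
    (hM : ‖t‖ * (C / Real.log 2) ≤ M) :
    ‖∫ v, Complex.exp ((inner ℝ t v : ℝ) * Complex.I) ∂scoreLaw PX b -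
      (1 - ((fisher PX b t / 2 : ℝ) : ℂ))‖ ≤ M ^ 3 * Real.exp M := by
  set μ := scoreLaw PX b
  have hR := ae_norm_le_scoreLaw hC b
  have hin : ∀ᵐ v ∂μ, |inner ℝ t v| ≤ M := hR.mono fun v hv =>
    (abs_inner_le_of_norm_le hv).trans hM
  have i1 : Integrable (fun v => inner ℝ t v) μ :=
    Integrable.of_bound (by fun_prop) M hin
  have i2 : Integrable (fun v => inner ℝ t v ^ 2 / 2) μ := by
    refine Integrable.of_bound (by fun_prop) (M ^ 2 / 2) ?_
    filter_upwards [hin] with v hv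
    rw [Real.norm_eq_abs, abs_div, abs_pow, abs_two]
    gcongr
  have i3 : Integrable (fun v => Complex.exp ((inner ℝ t v : ℝ) * Complex.I)) μ := by
    refine Integrable.of_bound (Continuous.aestronglyMeasurable (by fun_prop)) 1 ?_
    exact ae_of_all _ fun v => (Complex.norm_exp_ofReal_mul_I _).le
  -- The linear term integrates to 0 and the quadratic one to the Fisher form, so only the Taylor
  -- remainder is left to bound.
  have e : ∫ v, Complex.exp ((inner ℝ t v : ℝ) * Complex.I) ∂μ -
      (1 - ((fisher PX b t / 2 : ℝ) : ℂ)) =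
      ∫ v, (Complex.exp ((inner ℝ t v : ℝ) * Complex.I) -
        (1 + ((inner ℝ t v : ℝ) : ℂ) * Complex.I - ((inner ℝ t v ^ 2 / 2 : ℝ) : ℂ))) ∂μ := by
    have i1c : Integrable (fun v => ((inner ℝ t v : ℝ) : ℂ) * Complex.I) μ :=
      i1.ofReal.mul_const _
    have s1 : Integrable (fun v => 1 + ((inner ℝ t v : ℝ) : ℂ) * Complex.I) μ :=
      (integrable_const _).add i1c
    have s2 : Integrable (fun v => ((inner ℝ t v ^ 2 / 2 : ℝ) : ℂ)) μ := i2.ofReal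
    have s3 : Integrable (fun v => 1 + ((inner ℝ t v : ℝ) : ℂ) * Complex.I -
      ((inner ℝ t v ^ 2 / 2 : ℝ) : ℂ)) μ := s1.sub s2
    rw [integral_sub i3 s3, integral_sub s1 s2, integral_add (integrable_const _) i1c,
      integral_mul_const, integral_complex_ofReal, integral_complex_ofReal, integral_div,
      integral_inner_scoreLaw hC, integral_inner_sq_scoreLaw hC]
    simp
  rw [e]
  have h : ∀ᵐ v ∂μ, ‖Complex.exp ((inner ℝ t v : ℝ) * Complex.I) -
        (1 + ((inner ℝ t v : ℝ) : ℂ) * Complex.I - ((inner ℝ t v ^ 2 / 2 : ℝ) : ℂ))‖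
      ≤ M ^ 3 * Real.exp M := by
    filter_upwards [hin] with v hv
    have := Complex.norm_exp_sub_sum_le_norm_mul_exp ((inner ℝ t v : ℝ) * Complex.I) 3
    simp only [Finset.sum_range_succ, Finset.sum_range_zero, norm_mul, Complex.norm_I, mul_one,
      Complex.norm_real, Real.norm_eq_abs] at this
    have hM0 := (abs_nonneg _).trans hv
    refine (le_of_eq ?_).trans (this.trans (by gcongr))
    congr 2
    simp [mul_pow]
    ring
  refine (norm_integral_le_of_norm_le_const h).trans_eq ?_
  simp

end ScoreLaw

/-! ### Integration of the next observation -/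

namespace IsOnlineModel

variable [MeasurableSpace Ω] {P : Measure Ω} [IsProbabilityMeasure P] {PX : Measure (Vec d)}
  [IsProbabilityMeasure PX] {b₀ : Ω → Vec d} {X : ℕ → Ω → Vec d} {Y : ℕ → Ω → Fin 2} {C : ℝ}

/-- The predictive rule integrated over a history event, stated in `ℝ≥0∞` so that it can be compared
with measures having a density. -/
theorem measure_next (hM : IsOnlineModel P PX b₀ X Y C) (n : ℕ) {S : Set Ω}
    (hS : MeasurableSet[histSigma b₀ X Y n] S) {A : Set (Vec d)} (hA : MeasurableSet A)
    (y : Fin 2) :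
    P (S ∩ {ω | X (n + 1) ω ∈ A ∧ Y (n + 1) ω = y}) =
      ∫⁻ ω in S, ∫⁻ x in A, ENNReal.ofReal (lik x (beta b₀ X Y n ω) y) ∂PX ∂P := by
  have hle := hM.histSigma_le n
  have hT : MeasurableSet {ω | X (n + 1) ω ∈ A ∧ Y (n + 1) ω = y} :=
    (hM.meas_feature _ n.succ_pos hA).inter (hM.meas_label _ n.succ_pos (measurableSet_singleton y))
  set T := {ω | X (n + 1) ω ∈ A ∧ Y (n + 1) ω = y}
  have h1 := setIntegral_condExp hle ((integrable_const (1 : ℝ)).indicator (μ := P) hT) hS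
  rw [setIntegral_congr_ae (hle _ hS) ((hM.rule n A hA y).mono fun ω h _ => h),
    integral_indicator hT, Measure.restrict_restrict hT, setIntegral_const, smul_eq_mul,
    mul_one] at h1
  have hlik : ∀ ω, IntegrableOn (fun x => lik x (beta b₀ X Y n ω) y) A PX := fun ω =>
    Integrable.of_bound ((measurable_lik y measurable_id measurable_const).aestronglyMeasurable) 1
      (ae_of_all _ fun x => by
        rw [Real.norm_eq_abs, abs_of_nonneg (lik_nonneg _ _ _)]
        exact lik_le_one _ _ _)
  have hnn : ∀ ω, 0 ≤ ∫ x in A, lik x (beta b₀ X Y n ω) y ∂PX := fun ω =>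
    integral_nonneg fun x => lik_nonneg _ _ _
  have hmeas : StronglyMeasurable fun ω => ∫ x in A, lik x (beta b₀ X Y n ω) y ∂PX := by
    refine StronglyMeasurable.integral_prod_right
      (f := fun ω x => lik x (beta b₀ X Y n ω) y) ?_
    exact (measurable_lik y measurable_snd
      ((hM.measurable_beta n).comp measurable_fst)).stronglyMeasurable
  have hint : IntegrableOn (fun ω => ∫ x in A, lik x (beta b₀ X Y n ω) y ∂PX) S P := by
    refine Integrable.of_bound hmeas.aestronglyMeasurable 1 (ae_of_all _ fun ω => ?_)
    refine (norm_setIntegral_le_of_norm_le_const (C := 1) (measure_lt_top _ _) fun x _ => ?_).trans ?_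
    · rw [Real.norm_eq_abs, abs_of_nonneg (lik_nonneg _ _ _)]
      exact lik_le_one _ _ _
    · rw [one_mul]
      exact measureReal_le_one
  rw [Set.inter_comm, ← ofReal_measureReal, ← h1,
    ofReal_integral_eq_lintegral_ofReal hint (ae_of_all _ hnn)]
  refine lintegral_congr fun ω => ?_
  rw [ofReal_integral_eq_lintegral_ofReal (hlik ω) (ae_of_all _ fun x => lik_nonneg _ _ _)]

theorem ae_norm_feature_le (hM : IsOnlineModel P PX b₀ X Y C) (n : ℕ) :
    ∀ᵐ ω ∂P, ‖X (n + 1) ω‖ ≤ C := by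
  have hA : MeasurableSet {x : Vec d | ¬ ‖x‖ ≤ C} :=
    (measurableSet_le measurable_norm measurable_const).compl
  have h : ∀ y, P {ω | X (n + 1) ω ∈ {x : Vec d | ¬ ‖x‖ ≤ C} ∧ Y (n + 1) ω = y} = 0 := fun y => by
    have := hM.measure_next n MeasurableSet.univ hA y
    rw [Set.univ_inter] at this
    rw [this]
    have h0 : PX {x : Vec d | ¬ ‖x‖ ≤ C} = 0 := ae_iff.1 hM.feature_le
    simp only [setLIntegral_measure_zero _ _ h0, lintegral_zero]
  rw [ae_iff]
  refine measure_mono_null (fun ω hω => Set.mem_iUnion.2 ⟨Y (n + 1) ω, ?_⟩) (measure_iUnion_null h)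
  exact ⟨hω, rfl⟩

theorem ae_norm_score_le (hM : IsOnlineModel P PX b₀ X Y C) (n : ℕ) :
    ∀ᵐ ω ∂P, ‖score (Y (n + 1) ω) (X (n + 1) ω) (beta b₀ X Y n ω)‖ ≤ C / Real.log 2 := by
  have := log_two_pos
  filter_upwards [hM.ae_norm_feature_le n] with ω hω
  exact (norm_score_le _ _ _).trans (by gcongr)

variable {H : Type*} [MeasurableSpace H]

/-- On rectangles this is `measure_next`, and rectangles determine the measure. The next feature
behaves as if independent of the history, up to the likelihood as density. -/
theorem map_next (hM : IsOnlineModel P PX b₀ X Y C) (n : ℕ) {h : Ω → H}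
    (hh : Measurable[histSigma b₀ X Y n] h) (y : Fin 2) :
    (P.restrict (Y (n + 1) ⁻¹' {y})).map (fun ω => (h ω, X (n + 1) ω)) =
      ((P.prod PX).withDensity
        fun p => ENNReal.ofReal (lik p.2 (beta b₀ X Y n p.1) y)).map
          fun p => (h p.1, p.2) := by
  have hh' : Measurable h := hh.mono (hM.histSigma_le n) le_rfl
  have hX := hM.meas_feature _ n.succ_pos
  have hm1 : Measurable fun ω => (h ω, X (n + 1) ω) := hh'.prodMk hX
  have hm2 : Measurable fun p : Ω × Vec d => (h p.1, p.2) :=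
    (hh'.comp measurable_fst).prodMk measurable_snd
  have hd : Measurable fun p : Ω × Vec d => ENNReal.ofReal (lik p.2 (beta b₀ X Y n p.1) y) :=
    (measurable_lik y measurable_snd ((hM.measurable_beta n).comp measurable_fst)).ennreal_ofReal
  refine Measure.ext_prod fun {S A} hS hA => ?_
  have hpre : (fun p : Ω × Vec d => (h p.1, p.2)) ⁻¹' (S ×ˢ A) = (h ⁻¹' S) ×ˢ A := rfl
  rw [Measure.map_apply hm1 (hS.prod hA), Measure.map_apply hm2 (hS.prod hA), hpre,
    withDensity_apply _ ((hh' hS).prod hA), ← Measure.prod_restrict,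
    lintegral_prod _ hd.aemeasurable, ← hM.measure_next n (hh hS) hA y,
    Measure.restrict_apply (hm1 (hS.prod hA))]
  congr 1
  ext ω
  simp [and_assoc]

variable {E : Type*} [NormedAddCommGroup E] [NormedSpace ℝ E]

/-- Conditionally on the history, the next score has the law `scoreLaw PX β_n`. -/
theorem integral_next_score (hM : IsOnlineModel P PX b₀ X Y C) (n : ℕ) {h : Ω → H}
    (hh : Measurable[histSigma b₀ X Y n] h) {Φ : H → Vec d → E}
    (hΦ : StronglyMeasurable (Function.uncurry Φ)) {K : ℝ}
    (hK : ∀ᵐ ω ∂P, ∀ v, ‖v‖ ≤ C / Real.log 2 → ‖Φ (h ω) v‖ ≤ K) :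
    ∫ ω, Φ (h ω) (score (Y (n + 1) ω) (X (n + 1) ω) (beta b₀ X Y n ω)) ∂P =
      ∫ ω, ∫ v, Φ (h ω) v ∂scoreLaw PX (beta b₀ X Y n ω) ∂P := by
  have hl := log_two_pos
  have hh' : Measurable h := hh.mono (hM.histSigma_le n) le_rfl
  have hβ := hM.measurable_beta n
  have hX := hM.meas_feature _ n.succ_pos
  have hY := hM.meas_label _ n.succ_pos
  set β := beta b₀ X Y n
  have hd : ∀ y, Measurable fun p : Ω × Vec d => lik p.2 (β p.1) y := fun y =>
    measurable_lik y measurable_snd (hβ.comp measurable_fst)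
  have hpair : Measurable[histSigma b₀ X Y n] fun ω => (h ω, β ω) :=
    hh.prodMk (measurable_histSigma_beta b₀ X Y n)
  -- The score depends on `β` too, so `β` is carried along with `h`; once the label is fixed, the
  -- integrand is a function of a history variable and of the next feature.
  let F : Fin 2 → (H × Vec d) × Vec d → E := fun y p => Φ p.1.1 (score y p.2 p.1.2)
  have hF : ∀ y, StronglyMeasurable (F y) := fun y =>
    hΦ.comp_measurable ((measurable_fst.comp measurable_fst).prodMk
      (measurable_score measurable_const measurable_snd (measurable_snd.comp measurable_fst)))
  have hint : Integrable
      (fun ω => Φ (h ω) (score (Y (n + 1) ω) (X (n + 1) ω) (β ω))) P := by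
    refine Integrable.of_bound (C := K) (hΦ.comp_measurable
      (hh'.prodMk (measurable_score hY hX hβ))).aestronglyMeasurable ?_
    filter_upwards [hK, hM.ae_norm_score_le n] with ω h1 h2 using h1 _ h2
  have hsum : ∫ ω, Φ (h ω) (score (Y (n + 1) ω) (X (n + 1) ω) (β ω)) ∂P =
      ∑ y : Fin 2, ∫ ω in Y (n + 1) ⁻¹' {y}, F y ((h ω, β ω), X (n + 1) ω) ∂P := by
    have hms : ∀ y, MeasurableSet (Y (n + 1) ⁻¹' {y}) := fun y => hY (measurableSet_singleton y)
    rw [← setIntegral_univ]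
    have hU : (Set.univ : Set Ω) = ⋃ y, Y (n + 1) ⁻¹' {y} := by ext; simp
    rw [hU, integral_iUnion_fintype hms
      (fun i j hij => (Set.disjoint_singleton.2 hij).preimage _) fun i => hint.integrableOn]
    refine Finset.sum_congr rfl fun y _ => setIntegral_congr_fun (hms y) fun ω hω => ?_
    simp only [Set.mem_preimage, Set.mem_singleton_iff] at hω
    simp only [F, hω]
  have hterm : ∀ y, ∫ ω in Y (n + 1) ⁻¹' {y}, F y ((h ω, β ω), X (n + 1) ω) ∂P =
      ∫ p, lik p.2 (β p.1) y • F y ((h p.1, β p.1), p.2) ∂(P.prod PX) := fun y => by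
    have hm1 : Measurable fun ω => ((h ω, β ω), X (n + 1) ω) := (hh'.prodMk hβ).prodMk hX
    have hm2 : Measurable fun p : Ω × Vec d => ((h p.1, β p.1), p.2) :=
      ((hh'.prodMk hβ).comp measurable_fst).prodMk measurable_snd
    rw [← integral_map hm1.aemeasurable (hF y).aestronglyMeasurable, hM.map_next n hpair y,
      integral_map hm2.aemeasurable (hF y).aestronglyMeasurable,
      integral_withDensity_eq_integral_toReal_smul (hd y).ennreal_ofReal (by simp)]
    simp_rw [ENNReal.toReal_ofReal (lik_nonneg _ _ y)]
  have hi : ∀ y, Integrable (fun p : Ω × Vec d => lik p.2 (β p.1) y • F y ((h p.1, β p.1), p.2))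
      (P.prod PX) := fun y => by
    have hm2 : Measurable fun p : Ω × Vec d => ((h p.1, β p.1), p.2) :=
      ((hh'.prodMk hβ).comp measurable_fst).prodMk measurable_snd
    refine Integrable.of_bound (C := K)
      ((hd y).stronglyMeasurable.smul ((hF y).comp_measurable hm2)).aestronglyMeasurable ?_
    filter_upwards [Measure.quasiMeasurePreserving_fst.ae hK,
      Measure.quasiMeasurePreserving_snd.ae hM.feature_le] with p h1 h2
    have h3 := h1 (score y p.2 (β p.1)) ((norm_score_le _ _ _).trans (by gcongr))
    rw [norm_smul, Real.norm_eq_abs, abs_of_nonneg (lik_nonneg _ _ _)]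
    exact (mul_le_of_le_one_left (norm_nonneg _) (lik_le_one _ _ _)).trans h3
  rw [hsum]
  simp_rw [hterm]
  simp_rw [fun y => integral_prod _ (hi y)]
  rw [← integral_finsetSum _ fun y _ => (hi y).integral_prod_left]
  refine integral_congr_ae ?_
  filter_upwards [hK] with ω hω
  have hs : StronglyMeasurable (Φ (h ω)) :=
    hΦ.comp_measurable (measurable_const.prodMk measurable_id)
  exact (integral_scoreLaw hM.feature_le (β ω) hs hω).symm

end IsOnlineModel

/-! ### A strong law for bounded martingale differences -/

theorem summable_one_div_succ_sq : Summable fun k : ℕ => 1 / ((k : ℝ) + 1) ^ 2 := by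
  have := (summable_nat_add_iff 1).2 (Real.summable_one_div_nat_pow.2 one_lt_two)
  simpa using this

/-- If `D k` are uniformly bounded martingale differences, then `∑ D k / (k + 1)` converges. -/
theorem ae_exists_tendsto_sum_div [m0 : MeasurableSpace Ω] {P : Measure Ω} [IsProbabilityMeasure P]
    (G : Filtration ℕ m0) {D : ℕ → Ω → ℝ} {K : ℝ} (hD : ∀ n, Measurable[G (n + 1)] (D n))
    (hK : ∀ n, ∀ᵐ ω ∂P, |D n ω| ≤ K) (h0 : ∀ n, P[D n | G n] =ᵐ[P] 0) :
    ∀ᵐ ω ∂P, ∃ l, Tendsto (fun n => ∑ k ∈ Finset.range n, D k ω / (k + 1)) atTop (𝓝 l) := by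
  set S : ℕ → Ω → ℝ := fun n ω => ∑ k ∈ Finset.range n, D k ω / (k + 1) with hS
  have hDm : ∀ n, Measurable (D n) := fun n => (hD n).mono (G.le _) le_rfl
  have hDi : ∀ n, Integrable (D n) P := fun n =>
    Integrable.of_bound (hDm n).aestronglyMeasurable K (hK n)
  have hSm : ∀ n, Measurable[G n] (S n) := fun n =>
    @Finset.measurable_fun_sum _ _ _ _ _ _ (G n) _ _ fun k hk =>
      ((hD k).mono (G.mono (Finset.mem_range.1 hk)) le_rfl).div_const _
  have hSm' : ∀ n, Measurable (S n) := fun n => (hSm n).mono (G.le _) le_rfl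
  have hsucc : ∀ n, S (n + 1) = S n + fun ω => D n ω / (n + 1) := fun n => by
    ext ω
    simp [hS, Finset.sum_range_succ]
  -- This bound grows with `n` and serves only for integrability; the uniform bound comes from the
  -- second moments below.
  have hSK : ∀ n, ∀ᵐ ω ∂P, |S n ω| ≤ n * K := fun n => by
    filter_upwards [ae_all_iff.2 hK] with ω hω
    refine (Finset.abs_sum_le_sum_abs _ _).trans ?_
    refine (Finset.sum_le_sum fun k _ => ?_).trans_eq
      (b := ∑ _k ∈ Finset.range n, K) (by simp)
    have hk : (1 : ℝ) ≤ k + 1 := by linarith [k.cast_nonneg (α := ℝ)]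
    rw [abs_div, abs_of_pos (zero_lt_one.trans_le hk)]
    exact (div_le_self (abs_nonneg _) hk).trans (hω k)
  have hSi : ∀ n, Integrable (S n) P := fun n =>
    Integrable.of_bound (hSm' n).aestronglyMeasurable _ (hSK n)
  have hSDi : ∀ n, Integrable (S n * D n) P := fun n =>
    (hDi n).bdd_mul (hSm' n).aestronglyMeasurable (hSK n)
  -- Orthogonality of the increments: `S n` is known at time `n` and pulls out of the conditional
  -- expectation.
  have hcross : ∀ n, ∫ ω, S n ω * D n ω ∂P = 0 := fun n => by
    have h1 := condExp_mul_of_stronglyMeasurable_left (m := G n) (hSm n).stronglyMeasurable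
      (hSDi n) (hDi n)
    have h2 : P[S n * D n | G n] =ᵐ[P] 0 := by
      filter_upwards [h1, h0 n] with ω h3 h4
      simp [h3, h4]
    have h3 := integral_condExp (μ := P) (f := S n * D n) (G.le n)
    rw [integral_congr_ae h2] at h3
    simpa using h3.symm
  have hS2i : ∀ n, Integrable (fun ω => S n ω ^ 2) P := fun n => by
    refine Integrable.of_bound ((hSm' n).pow_const 2).aestronglyMeasurable ((n * K) ^ 2) ?_
    filter_upwards [hSK n] with ω hω
    rw [norm_pow, Real.norm_eq_abs]
    gcongr
  have hL2 : ∀ n, ∫ ω, S n ω ^ 2 ∂P ≤ K ^ 2 * ∑ k ∈ Finset.range n, 1 / ((k : ℝ) + 1) ^ 2 := by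
    intro n
    induction n with
    | zero => simp [hS]
    | succ n ih =>
      have hD2i : Integrable (fun ω => (D n ω / (n + 1)) ^ 2) P := by
        refine Integrable.of_bound (((hDm n).div_const _).pow_const 2).aestronglyMeasurable
          ((K / (n + 1)) ^ 2) ?_
        filter_upwards [hK n] with ω hω
        rw [norm_pow, norm_div, Real.norm_eq_abs, Real.norm_eq_abs,
          abs_of_pos (by positivity : (0 : ℝ) < n + 1)]
        gcongr
      have hD2 : ∫ ω, (D n ω / (n + 1)) ^ 2 ∂P ≤ K ^ 2 * (1 / ((n : ℝ) + 1) ^ 2) := by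
        have : ∫ ω, (D n ω / (n + 1)) ^ 2 ∂P ≤ ∫ _ω, K ^ 2 * (1 / ((n : ℝ) + 1) ^ 2) ∂P := by
          refine integral_mono_ae hD2i (integrable_const _) ?_
          filter_upwards [hK n] with ω hω
          have h1 : D n ω ^ 2 ≤ K ^ 2 := sq_le_sq' (by linarith [neg_le_of_abs_le hω])
            (le_of_abs_le hω)
          rw [div_pow, mul_one_div]
          gcongr
        simpa using this
      have e : ∀ ω, S (n + 1) ω ^ 2 =
          (S n ω ^ 2 + 2 / (n + 1) * (S n ω * D n ω)) + (D n ω / (n + 1)) ^ 2 := fun ω => by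
        rw [hsucc, Pi.add_apply]
        ring
      simp_rw [e]
      have hSDi' : Integrable (fun ω => 2 / ((n : ℝ) + 1) * (S n ω * D n ω)) P :=
        (hSDi n).const_mul _
      have hi' : Integrable (fun ω => S n ω ^ 2 + 2 / ((n : ℝ) + 1) * (S n ω * D n ω)) P :=
        (hS2i n).add hSDi'
      rw [integral_add hi' hD2i, integral_add (hS2i n) hSDi', integral_const_mul, hcross,
        Finset.sum_range_succ, mul_add, mul_zero, add_zero]
      exact add_le_add ih hD2
  set A := ∑' k : ℕ, 1 / ((k : ℝ) + 1) ^ 2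
  -- An L¹ bound is what Doob's convergence theorem needs; |x| ≤ 1 + x² derives it from the L²
  -- bound.
  have hL1 : ∀ n, ∫ ω, ‖S n ω‖ ∂P ≤ 1 + K ^ 2 * A := fun n => by
    have h1 : ∫ ω, ‖S n ω‖ ∂P ≤ ∫ ω, (1 + S n ω ^ 2) ∂P := by
      refine integral_mono (hSi n).norm ((integrable_const _).add (hS2i n)) fun ω => ?_
      rw [Real.norm_eq_abs, ← sq_abs (S n ω)]
      nlinarith [sq_nonneg (|S n ω| - 1), abs_nonneg (S n ω)]
    rw [integral_add (integrable_const _) (hS2i n)] at h1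
    have h2 : ∑ k ∈ Finset.range n, 1 / ((k : ℝ) + 1) ^ 2 ≤ A :=
      summable_one_div_succ_sq.sum_le_tsum _ fun _ _ => by positivity
    have h3 := (hL2 n).trans (mul_le_mul_of_nonneg_left h2 (sq_nonneg K))
    simp only [integral_const, probReal_univ, smul_eq_mul, one_mul] at h1
    linarith
  have hmart : Martingale S G P :=
    martingale_of_condExp_sub_eq_zero_nat (fun n => (hSm n).stronglyMeasurable) hSi fun n => by
      rw [hsucc, add_sub_cancel_left]
      have h1 : (fun ω => D n ω / ((n : ℝ) + 1)) = (1 / ((n : ℝ) + 1)) • D n := by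
        ext ω
        simp only [Pi.smul_apply, smul_eq_mul]
        ring
      rw [h1]
      filter_upwards [condExp_smul (μ := P) (1 / ((n : ℝ) + 1)) (D n) (G n), h0 n] with ω h2 h3
      rw [h2, Pi.smul_apply, h3, Pi.zero_apply, smul_zero]
  refine hmart.submartingale.exists_ae_tendsto_of_bdd (R := (1 + K ^ 2 * A).toNNReal) fun n => ?_
  rw [eLpNorm_one_eq_lintegral_enorm, ← ofReal_integral_norm_eq_lintegral_enorm (hSi n)]
  exact ENNReal.ofReal_le_ofReal (hL1 n)

/-- **Kronecker's lemma** for the weights `k + 1`. -/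
theorem tendsto_average_of_tendsto_sum_div {a : ℕ → ℝ} {l : ℝ}
    (h : Tendsto (fun n => ∑ k ∈ Finset.range n, a k / (k + 1)) atTop (𝓝 l)) :
    Tendsto (fun n : ℕ => (n : ℝ)⁻¹ * ∑ k ∈ Finset.range n, a k) atTop (𝓝 0) := by
  set s : ℕ → ℝ := fun n => ∑ k ∈ Finset.range n, a k / (k + 1) with hs
  -- Summation by parts. After division by `n` both terms tend to `l`, the second as a Cesàro mean.
  have e : ∀ n : ℕ, ∑ k ∈ Finset.range n, a k = n * s n - ∑ k ∈ Finset.range n, s k := by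
    intro n
    induction n with
    | zero => simp
    | succ n ih =>
      have hn : (n : ℝ) + 1 ≠ 0 := by positivity
      have h1 : s (n + 1) = s n + a n / (n + 1) := by simp [hs, Finset.sum_range_succ]
      rw [Finset.sum_range_succ, ih, Finset.sum_range_succ _ n, h1]
      push_cast
      field_simp
      ring
  have h2 : Tendsto (fun n : ℕ => s n - (n : ℝ)⁻¹ * ∑ k ∈ Finset.range n, s k) atTop (𝓝 0) := by
    simpa using h.sub h.cesaro
  refine h2.congr' ?_
  filter_upwards [eventually_ne_atTop 0] with n hn
  have hn' : (n : ℝ) ≠ 0 := by exact_mod_cast hn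
  rw [e, mul_sub, inv_mul_cancel_left₀ hn']

/-! ### Convergence of the iterates and of `V_n` -/

theorem beta_apply_eq_sum (b₀ : Ω → Vec d) (X : ℕ → Ω → Vec d) (Y : ℕ → Ω → Fin 2) (n : ℕ)
    (ω : Ω) (i : Fin d) :
    beta b₀ X Y n ω i = b₀ ω i + ∑ k ∈ Finset.range n,
      score (Y (k + 1) ω) (X (k + 1) ω) (beta b₀ X Y k ω) i / (k + 1) := by
  induction n with
  | zero => simp [beta]
  | succ n ih =>
    rw [beta_succ, Finset.sum_range_succ, ← add_assoc, ← ih, PiLp.add_apply, PiLp.smul_apply,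
      smul_eq_mul, one_div_mul_eq_div]

/-- The factor k² cancels the two step sizes 1/k, which leaves a plain average of products of
scores. -/
theorem V_apply_eq_sum (b₀ : Ω → Vec d) (X : ℕ → Ω → Vec d) (Y : ℕ → Ω → Fin 2) (n : ℕ)
    (ω : Ω) (i j : Fin d) :
    V b₀ X Y n ω i j = (n : ℝ)⁻¹ * ∑ k ∈ Finset.range n,
      (score (Y (k + 1) ω) (X (k + 1) ω) (beta b₀ X Y k ω) i *
        score (Y (k + 1) ω) (X (k + 1) ω) (beta b₀ X Y k ω) j) := by
  rw [V, Matrix.smul_apply, smul_eq_mul, one_div]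
  congr 1
  induction n with
  | zero => simp
  | succ n ih =>
    rw [Finset.sum_Icc_succ_top (Nat.le_add_left 1 n), Matrix.add_apply, ih,
      Finset.sum_range_succ]
    congr 1
    have hn : (n : ℝ) + 1 ≠ 0 := by positivity
    simp only [Nat.add_sub_cancel, beta_succ, Matrix.smul_apply, Matrix.vecMulVec_apply,
      PiLp.add_apply, PiLp.smul_apply, add_sub_cancel_left, smul_eq_mul]
    push_cast
    field_simp

namespace IsOnlineModel

variable [MeasurableSpace Ω] {P : Measure Ω} [IsProbabilityMeasure P] {PX : Measure (Vec d)}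
  [IsProbabilityMeasure PX] {b₀ : Ω → Vec d} {X : ℕ → Ω → Vec d} {Y : ℕ → Ω → Fin 2} {C : ℝ}

/-- The filtration generated by the observations. -/
def filtration {P : Measure Ω} {PX : Measure (Vec d)} (hM : IsOnlineModel P PX b₀ X Y C) :
    Filtration ℕ ‹MeasurableSpace Ω› where
  seq := histSigma b₀ X Y
  mono' := histSigma_mono b₀ X Y
  le' := hM.histSigma_le

/-- `integral_next_score` with the indicator of a history event as history variable is the defining
property of the conditional expectation. -/
theorem condExp_next_score (hM : IsOnlineModel P PX b₀ X Y C) (n : ℕ) {φ ψ : Vec d → ℝ}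
    (hφ : Measurable φ) (hψ : Measurable ψ) {K : ℝ}
    (hK : ∀ v, ‖v‖ ≤ C / Real.log 2 → |φ v| ≤ K)
    (h : ∀ b, ∫ v, φ v ∂scoreLaw PX b = ψ b) :
    P[fun ω => φ (score (Y (n + 1) ω) (X (n + 1) ω) (beta b₀ X Y n ω)) | histSigma b₀ X Y n]
      =ᵐ[P] fun ω => ψ (beta b₀ X Y n ω) := by
  have hle := hM.histSigma_le n
  have hβ := hM.measurable_beta n
  have hsc : Measurable fun ω => score (Y (n + 1) ω) (X (n + 1) ω) (beta b₀ X Y n ω) :=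
    measurable_score (hM.meas_label _ n.succ_pos) (hM.meas_feature _ n.succ_pos) hβ
  have hψK : ∀ b, |ψ b| ≤ K := fun b => by
    rw [← h]
    have := norm_integral_le_of_norm_le_const (f := φ)
      ((ae_norm_le_scoreLaw hM.feature_le b).mono hK)
    simpa using this
  refine (ae_eq_condExp_of_forall_setIntegral_eq hle ?_ (fun S _ _ => ?_) (fun S hS _ => ?_)
    ?_).symm
  · refine Integrable.of_bound (hφ.comp hsc).aestronglyMeasurable K ?_
    filter_upwards [hM.ae_norm_score_le n] with ω hω using hK _ hω
  · exact Integrable.of_bound (hψ.comp hβ).aestronglyMeasurable K (ae_of_all _ fun ω => hψK _)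
  · have hind : Measurable[histSigma b₀ X Y n] (S.indicator fun _ => (1 : ℝ)) :=
      measurable_const.indicator hS
    have := hM.integral_next_score n hind (Φ := fun a v => a * φ v)
      (Measurable.stronglyMeasurable (measurable_fst.mul (hφ.comp measurable_snd))) (K := K)
      (ae_of_all _ fun ω v hv => by
        rw [norm_mul]
        refine (mul_le_of_le_one_left (norm_nonneg _) ?_).trans (hK v hv)
        by_cases hω : ω ∈ S <;> simp [hω])
    simp only [integral_const_mul, h] at this
    rw [← integral_indicator (hle _ hS), ← integral_indicator (hle _ hS)]
    have e : ∀ f : Ω → ℝ, ∫ ω, S.indicator f ω ∂P =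
        ∫ ω, S.indicator (fun _ => (1 : ℝ)) ω * f ω ∂P := fun f => by
      congr 1 with ω
      by_cases hω : ω ∈ S <;> simp [hω]
    rw [e, e]
    exact this.symm
  · exact (hψ.comp (measurable_histSigma_beta b₀ X Y n)).stronglyMeasurable.aestronglyMeasurable

theorem ae_exists_tendsto_beta (hM : IsOnlineModel P PX b₀ X Y C) :
    ∀ᵐ ω ∂P, ∃ l, Tendsto (fun n => beta b₀ X Y n ω) atTop (𝓝 l) := by
  have h : ∀ i : Fin d, ∀ᵐ ω ∂P, ∃ l, Tendsto (fun n => ∑ k ∈ Finset.range n,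
      score (Y (k + 1) ω) (X (k + 1) ω) (beta b₀ X Y k ω) i / (k + 1)) atTop (𝓝 l) := fun i => by
    refine ae_exists_tendsto_sum_div hM.filtration (K := C / Real.log 2) (fun n => ?_)
      (fun n => ?_) fun n => ?_
    · exact (by fun_prop : Measurable fun v : Vec d => v i).comp
        (measurable_histSigma_score b₀ X Y (measurable_histSigma_beta b₀ X Y n))
    · filter_upwards [hM.ae_norm_score_le n] with ω hω using (abs_apply_le_norm _ i).trans hω
    · exact hM.condExp_next_score n (φ := fun v => v i) (ψ := fun _ => 0) (by fun_prop)
        measurable_const (fun v hv => (abs_apply_le_norm v i).trans hv)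
        fun b => integral_apply_scoreLaw hM.feature_le b i
  filter_upwards [ae_all_iff.2 h] with ω hω
  choose l hl using hω
  refine ⟨WithLp.toLp 2 fun i => b₀ ω i + l i, ?_⟩
  refine ((PiLp.continuous_toLp 2 _).tendsto _).comp
    (f := fun n i => beta b₀ X Y n ω i) (tendsto_pi_nhds.2 fun i => ?_)
  simp only [beta_apply_eq_sum]
  exact tendsto_const_nhds.add (hl i)

/-- The products of scores minus their conditional means U(β_k) average to 0 by the strong law; the
means converge by continuity of `U`, hence so do their averages. -/
theorem ae_tendsto_V (hM : IsOnlineModel P PX b₀ X Y C) {βlim : Ω → Vec d}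
    (hβ : ∀ᵐ ω ∂P, Tendsto (fun n => beta b₀ X Y n ω) atTop (𝓝 (βlim ω))) :
    ∀ᵐ ω ∂P, Tendsto (fun n => V b₀ X Y n ω) atTop (𝓝 (U PX (βlim ω))) := by
  have hU := continuous_U hM.feature_le
  have hUij : ∀ i j, Continuous fun b => U PX b i j := fun i j => hU.matrix_elem i j
  have h : ∀ i j : Fin d, ∀ᵐ ω ∂P, ∃ l, Tendsto (fun n => ∑ k ∈ Finset.range n,
      (score (Y (k + 1) ω) (X (k + 1) ω) (beta b₀ X Y k ω) i *
        score (Y (k + 1) ω) (X (k + 1) ω) (beta b₀ X Y k ω) j - U PX (beta b₀ X Y k ω) i j)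
          / (k + 1)) atTop (𝓝 l) := fun i j => by
    have hb : ∀ v : Vec d, ‖v‖ ≤ C / Real.log 2 →
        |v i * v j| ≤ C / Real.log 2 * (C / Real.log 2) :=
      fun v hv => abs_apply_mul_apply_le hv i j
    have hUb : ∀ b, |U PX b i j| ≤ C / Real.log 2 * (C / Real.log 2) := fun b => by
      rw [← integral_mul_scoreLaw hM.feature_le]
      have := norm_integral_le_of_norm_le_const (f := fun v : Vec d => v i * v j)
        ((ae_norm_le_scoreLaw hM.feature_le b).mono hb)
      simpa using this
    have hmeas : ∀ n, Measurable[histSigma b₀ X Y (n + 1)] fun ω =>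
        (score (Y (n + 1) ω) (X (n + 1) ω) (beta b₀ X Y n ω) i *
          score (Y (n + 1) ω) (X (n + 1) ω) (beta b₀ X Y n ω) j) := fun n =>
      (by fun_prop : Measurable fun v : Vec d => v i * v j).comp
        (measurable_histSigma_score b₀ X Y (measurable_histSigma_beta b₀ X Y n))
    have hmeasU : ∀ n, Measurable[histSigma b₀ X Y n] fun ω => U PX (beta b₀ X Y n ω) i j :=
      fun n => (hUij i j).measurable.comp (measurable_histSigma_beta b₀ X Y n)
    have hUi : ∀ n, Integrable (fun ω => U PX (beta b₀ X Y n ω) i j) P := fun n =>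
      Integrable.of_bound
        ((hmeasU n).mono (hM.histSigma_le n) le_rfl).aestronglyMeasurable _
        (ae_of_all _ fun ω => hUb _)
    refine ae_exists_tendsto_sum_div hM.filtration
      (K := C / Real.log 2 * (C / Real.log 2) + C / Real.log 2 * (C / Real.log 2)) (fun n => ?_)
      (fun n => ?_) fun n => ?_
    · exact (hmeas n).sub ((hmeasU n).mono (histSigma_mono b₀ X Y n.le_succ) le_rfl)
    · filter_upwards [hM.ae_norm_score_le n] with ω hω
      exact (abs_sub _ _).trans (add_le_add (hb _ hω) (hUb _))
    · have h1 := hM.condExp_next_score n (φ := fun v => v i * v j) (ψ := fun b => U PX b i j)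
        (by fun_prop) (hUij i j).measurable hb fun b => integral_mul_scoreLaw hM.feature_le b i j
      have h2 := condExp_sub (m := histSigma b₀ X Y n) (μ := P)
        (Integrable.of_bound (C := C / Real.log 2 * (C / Real.log 2))
          ((hmeas n).mono (hM.histSigma_le _) le_rfl).aestronglyMeasurable
          ((hM.ae_norm_score_le n).mono fun ω hω => hb _ hω)) (hUi n)
      rw [condExp_of_stronglyMeasurable (hM.histSigma_le n) (hmeasU n).stronglyMeasurable
        (hUi n)] at h2
      refine h2.trans ?_
      filter_upwards [h1] with ω hω
      simp [hω]
  filter_upwards [ae_all_iff.2 fun i => ae_all_iff.2 (h i), hβ] with ω hω hβω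
  refine tendsto_pi_nhds.2 fun i => tendsto_pi_nhds.2 fun j => ?_
  obtain ⟨l, hl⟩ := hω i j
  have h1 := tendsto_average_of_tendsto_sum_div hl
  have h2 := (((hUij i j).tendsto _).comp hβω).cesaro
  have h3 := h1.add h2
  rw [zero_add] at h3
  refine h3.congr fun n => ?_
  rw [V_apply_eq_sum, ← mul_add, ← Finset.sum_add_distrib]
  simp

end IsOnlineModel

/-! ### Conditional second moments of the increments -/

namespace IsOnlineModel

variable [MeasurableSpace Ω] {P : Measure Ω} [IsProbabilityMeasure P] {PX : Measure (Vec d)}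
  [IsProbabilityMeasure PX] {b₀ : Ω → Vec d} {X : ℕ → Ω → Vec d} {Y : ℕ → Ω → Fin 2} {C : ℝ}

/-- A crude bound, used only to make the integrands below bounded. -/
theorem ae_norm_beta_sub_le (hM : IsOnlineModel P PX b₀ X Y C) (n k : ℕ) :
    ∀ᵐ ω ∂P, ‖beta b₀ X Y (n + k) ω - beta b₀ X Y n ω‖ ≤ k * (C / Real.log 2) := by
  induction k with
  | zero => simp
  | succ k ih =>
    filter_upwards [ih, hM.ae_norm_score_le (n + k)] with ω h1 h2
    have hk : (1 : ℝ) ≤ ((n + k : ℕ) : ℝ) + 1 := by linarith [(n + k).cast_nonneg (α := ℝ)]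
    rw [← add_assoc, beta_succ, add_sub_right_comm]
    refine (norm_add_le _ _).trans ?_
    have h3 : ‖(1 / (((n + k : ℕ) : ℝ) + 1)) •
        score (Y (n + k + 1) ω) (X (n + k + 1) ω) (beta b₀ X Y (n + k) ω)‖ ≤ C / Real.log 2 := by
      rw [norm_smul, norm_div, norm_one, Real.norm_eq_abs,
        abs_of_pos (zero_lt_one.trans_le hk), one_div_mul_eq_div]
      exact (div_le_self (norm_nonneg _) hk).trans h2
    push_cast at h3 ⊢
    linarith

theorem integrable_norm_beta_sub_sq (hM : IsOnlineModel P PX b₀ X Y C) (n k : ℕ) :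
    Integrable (fun ω => ‖beta b₀ X Y (n + k) ω - beta b₀ X Y n ω‖ ^ 2) P := by
  refine Integrable.of_bound (((hM.measurable_beta _).sub
    (hM.measurable_beta _)).norm.pow_const 2).aestronglyMeasurable
    ((k * (C / Real.log 2)) ^ 2) ?_
  filter_upwards [hM.ae_norm_beta_sub_le n k] with ω hω
  rw [norm_pow, norm_norm]
  gcongr

theorem integrable_norm_beta_sub (hM : IsOnlineModel P PX b₀ X Y C) (n k : ℕ) :
    Integrable (fun ω => ‖beta b₀ X Y (n + k) ω - beta b₀ X Y n ω‖) P := by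
  refine Integrable.of_bound ((hM.measurable_beta _).sub
    (hM.measurable_beta _)).norm.aestronglyMeasurable (k * (C / Real.log 2)) ?_
  filter_upwards [hM.ae_norm_beta_sub_le n k] with ω hω
  rwa [norm_norm]

theorem setIntegral_inner_next_score (hM : IsOnlineModel P PX b₀ X Y C) (n k : ℕ) {B : Set Ω}
    (hB : MeasurableSet[histSigma b₀ X Y n] B) :
    ∫ ω in B, inner ℝ (beta b₀ X Y (n + k) ω - beta b₀ X Y n ω)
      (score (Y (n + k + 1) ω) (X (n + k + 1) ω) (beta b₀ X Y (n + k) ω)) ∂P = 0 := by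
  have hδ : Measurable[histSigma b₀ X Y (n + k)]
      (B.indicator fun ω => beta b₀ X Y (n + k) ω - beta b₀ X Y n ω) :=
    ((measurable_histSigma_beta b₀ X Y (n + k)).sub
      (measurable_histSigma_beta_le b₀ X Y (Nat.le_add_right n k))).indicator
      (histSigma_mono b₀ X Y (Nat.le_add_right n k) _ hB)
  have := hM.integral_next_score (n + k) hδ (Φ := fun a v => (inner ℝ a v : ℝ))
    (Continuous.stronglyMeasurable (by fun_prop))
    (K := k * (C / Real.log 2) * (C / Real.log 2)) (by
      filter_upwards [hM.ae_norm_beta_sub_le n k] with ω hω v hv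
      refine (abs_inner_le_of_norm_le hv).trans ?_
      have h0 := (norm_nonneg v).trans hv
      gcongr
      by_cases h : ω ∈ B
      · simpa [h] using hω
      · simp only [h, not_false_eq_true, Set.indicator_of_notMem, norm_zero]
        positivity)
  simp_rw [integral_inner_scoreLaw hM.feature_le, integral_zero] at this
  rw [← integral_indicator (hM.histSigma_le n _ hB), ← this]
  congr 1 with ω
  by_cases h : ω ∈ B <;> simp [h]

/-- Increments are orthogonal on every history event, and 1/(m+1)² ≤ 1/m - 1/(m+1) telescopes. The
factor P(B) is kept because the bound is later read conditionally. -/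
theorem setIntegral_norm_beta_sub_sq_le (hM : IsOnlineModel P PX b₀ X Y C) {n : ℕ} (hn : 1 ≤ n)
    (k : ℕ) {B : Set Ω} (hB : MeasurableSet[histSigma b₀ X Y n] B) :
    ∫ ω in B, ‖beta b₀ X Y (n + k) ω - beta b₀ X Y n ω‖ ^ 2 ∂P ≤
      (C / Real.log 2) ^ 2 * (1 / n - 1 / (n + k)) * P.real B := by
  induction k with
  | zero => simp
  | succ k ih =>
    set R := C / Real.log 2
    have hnk : (0 : ℝ) < n + k := by
      have : (1 : ℝ) ≤ n := by exact_mod_cast hn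
      positivity
    set δ : Ω → Vec d := fun ω => beta b₀ X Y (n + k) ω - beta b₀ X Y n ω
    set s : Ω → Vec d := fun ω =>
      score (Y (n + k + 1) ω) (X (n + k + 1) ω) (beta b₀ X Y (n + k) ω)
    have hδm : Measurable δ := (hM.measurable_beta _).sub (hM.measurable_beta _)
    have hsm : Measurable s := measurable_score (hM.meas_label _ (Nat.succ_pos _))
      (hM.meas_feature _ (Nat.succ_pos _)) (hM.measurable_beta _)
    have e : ∀ ω, ‖beta b₀ X Y (n + (k + 1)) ω - beta b₀ X Y n ω‖ ^ 2 =
        (‖δ ω‖ ^ 2 + 2 / (n + k + 1) * inner ℝ (δ ω) (s ω)) +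
          1 / ((n : ℝ) + k + 1) ^ 2 * ‖s ω‖ ^ 2 := fun ω => by
      rw [← add_assoc, beta_succ, add_sub_right_comm, norm_add_sq_real, inner_smul_right,
        norm_smul, mul_pow, Real.norm_eq_abs, sq_abs]
      change ‖δ ω‖ ^ 2 + 2 * (_ * inner ℝ (δ ω) (s ω)) + _ * ‖s ω‖ ^ 2 = _
      push_cast
      rw [one_div, one_div, inv_pow]
      ring
    have i1 : Integrable (fun ω => ‖δ ω‖ ^ 2) (P.restrict B) :=
      (hM.integrable_norm_beta_sub_sq n k).integrableOn
    have i2 : Integrable (fun ω => 2 / ((n : ℝ) + k + 1) * inner ℝ (δ ω) (s ω))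
        (P.restrict B) := by
      refine Integrable.integrableOn (Integrable.const_mul ?_ _)
      refine Integrable.of_bound (hδm.inner hsm).aestronglyMeasurable (k * R * R) ?_
      filter_upwards [hM.ae_norm_beta_sub_le n k, hM.ae_norm_score_le (n + k)] with ω h1 h2
      refine (abs_inner_le_of_norm_le h2).trans ?_
      have h0 := (norm_nonneg _).trans h2
      gcongr
    have hs2 : ∀ᵐ ω ∂P, ‖‖s ω‖ ^ 2‖ ≤ R ^ 2 := by
      filter_upwards [hM.ae_norm_score_le (n + k)] with ω h2
      rw [norm_pow, norm_norm]
      gcongr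
    have i3' : Integrable (fun ω => ‖s ω‖ ^ 2) (P.restrict B) :=
      (Integrable.of_bound (hsm.norm.pow_const 2).aestronglyMeasurable _ hs2).integrableOn
    have i3 := i3'.const_mul (1 / ((n : ℝ) + k + 1) ^ 2)
    have i12 : Integrable (fun ω => ‖δ ω‖ ^ 2 + 2 / ((n : ℝ) + k + 1) * inner ℝ (δ ω) (s ω))
      (P.restrict B) := i1.add i2
    have h3 : ∫ ω in B, ‖s ω‖ ^ 2 ∂P ≤ R ^ 2 * P.real B := by
      have := norm_setIntegral_le_of_norm_le_const_ae' (μ := P) (s := B) (measure_lt_top _ _)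
        (hs2.mono fun ω h _ => h)
      exact (Real.le_norm_self _).trans this
    simp_rw [e]
    rw [integral_add i12 i3, integral_add i1 i2, integral_const_mul, integral_const_mul,
      hM.setIntegral_inner_next_score n k hB, mul_zero, add_zero]
    have h4 : 1 / ((n : ℝ) + k + 1) ^ 2 ≤ 1 / (n + k) - 1 / (n + k + 1) := by
      rw [div_sub_div _ _ hnk.ne' (by positivity), div_le_div_iff₀ (by positivity) (by positivity)]
      nlinarith
    calc _ ≤ R ^ 2 * (1 / n - 1 / (n + k)) * P.real B +
          1 / ((n : ℝ) + k + 1) ^ 2 * (R ^ 2 * P.real B) := by gcongr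
      _ ≤ R ^ 2 * (1 / n - 1 / (n + k)) * P.real B +
          (1 / (n + k) - 1 / (n + k + 1)) * (R ^ 2 * P.real B) := by gcongr
      _ = _ := by
        push_cast
        ring

theorem setIntegral_norm_beta_sub_le (hM : IsOnlineModel P PX b₀ X Y C) {n : ℕ} (hn : 1 ≤ n)
    (k : ℕ) {B : Set Ω} (hB : MeasurableSet[histSigma b₀ X Y n] B) :
    ∫ ω in B, ‖beta b₀ X Y (n + k) ω - beta b₀ X Y n ω‖ ∂P ≤
      ((C / Real.log 2) ^ 2 + 1) / Real.sqrt n * P.real B := by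
  have hn' : (0 : ℝ) < n := by exact_mod_cast hn
  set r := Real.sqrt n
  have hr : 0 < r := Real.sqrt_pos.2 hn'
  have hrn : r ^ 2 = n := Real.sq_sqrt hn'.le
  have i1 := hM.integrable_norm_beta_sub n k
  have i2 := (hM.integrable_norm_beta_sub_sq n k).const_mul r
  have h1 := hM.setIntegral_norm_beta_sub_sq_le hn k hB
  -- A weighted arithmetic–geometric inequality x ≤ r x² + 1/r replaces Cauchy–Schwarz; r = √n
  -- balances the two terms.
  have h2 : ∫ ω in B, ‖beta b₀ X Y (n + k) ω - beta b₀ X Y n ω‖ ∂P ≤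
      ∫ ω in B, (r * ‖beta b₀ X Y (n + k) ω - beta b₀ X Y n ω‖ ^ 2 + 1 / r) ∂P := by
    refine integral_mono i1.integrableOn
      (i2.integrableOn.add (integrable_const (1 / r))) fun ω => ?_
    set x := ‖beta b₀ X Y (n + k) ω - beta b₀ X Y n ω‖
    have : 0 ≤ (r * x - 1) ^ 2 / r + x := by positivity
    have e : (r * x - 1) ^ 2 / r + x = r * x ^ 2 + 1 / r - x := by
      field_simp
      ring
    change x ≤ r * x ^ 2 + 1 / r
    linarith
  rw [integral_add i2.integrableOn (integrable_const _), integral_const_mul, setIntegral_const,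
    smul_eq_mul] at h2
  have h3 : (C / Real.log 2) ^ 2 * (1 / n - 1 / (n + k)) * P.real B ≤
      (C / Real.log 2) ^ 2 * (1 / n) * P.real B := by
    gcongr
    have : (0 : ℝ) ≤ 1 / (n + k) := by positivity
    linarith
  refine h2.trans ((add_le_add_left (mul_le_mul_of_nonneg_left (h1.trans h3) hr.le) _).trans_eq ?_)
  rw [← hrn]
  field_simp

end IsOnlineModel

/-! ### A conditional central limit theorem with rate -/

/-- The part of the error constant that comes from the Taylor expansions. -/
noncomputable def taylorConst (q : ℝ) : ℝ :=
  q ^ 3 * Real.exp q + q ^ 4 * Real.exp (q ^ 2) + q ^ 2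

/-- The part of the error constant that comes from the variation of the Fisher information. -/
noncomputable def fisherConst (C M : ℝ) : ℝ := (Real.log 2 ^ 2)⁻¹ * C ^ 3 * M ^ 2

theorem fisher_smul (PX : Measure (Vec d)) (b t : Vec d) (c : ℝ) :
    fisher PX b (c • t) = c ^ 2 * fisher PX b t := by
  simp only [fisher, real_inner_smul_left, mul_pow, mul_assoc, integral_const_mul]
  ring

theorem measurable_fisher (PX : Measure (Vec d)) [IsProbabilityMeasure PX] :
    Measurable fun p : Vec d × Vec d => fisher PX p.1 p.2 := by
  simp only [fisher]
  refine Measurable.const_mul (StronglyMeasurable.measurable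
    (StronglyMeasurable.integral_prod_right
      (f := fun (p : Vec d × Vec d) x => inner ℝ p.2 x ^ 2 * (g x p.1 * (1 - g x p.1))) ?_)) _
  have hg : Measurable fun q : (Vec d × Vec d) × Vec d => g q.2 q.1.1 :=
    measurable_g measurable_snd (measurable_fst.comp measurable_fst)
  have hi : Measurable fun q : (Vec d × Vec d) × Vec d => (inner ℝ q.1.2 q.2 : ℝ) :=
    (measurable_snd.comp measurable_fst).inner measurable_snd
  exact ((hi.pow_const 2).mul (hg.mul (measurable_const.sub hg))).stronglyMeasurable

/-- One step of the interpolation. With c = √n/(m+1) and a = n/m - n/(m+1), the score contributes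
variance c² and the Gaussian factor a. Every error is a multiple of a, which will telescope, times
either 1/√n or the change of the parameter from `b` to `b'`. -/
theorem norm_integral_exp_sub_exp_le {PX : Measure (Vec d)} [IsProbabilityMeasure PX] {C : ℝ}
    (hC : ∀ᵐ x ∂PX, ‖x‖ ≤ C) (hC0 : 0 ≤ C) {b b' T : Vec d} {M : ℝ} (hT : ‖T‖ ≤ M) {n m : ℕ}
    (hn : 1 ≤ n) (hnm : n ≤ m) :
    ‖∫ v, Complex.exp ((inner ℝ ((Real.sqrt n / (m + 1)) • T) v : ℝ) * Complex.I)
        ∂scoreLaw PX b' -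
      (Real.exp (-(fisher PX b T * (n / m - n / (m + 1))) / 2) : ℂ)‖ ≤
      ((n : ℝ) / m - n / (m + 1)) *
        (taylorConst (M * (C / Real.log 2)) / Real.sqrt n + fisherConst C M * ‖b' - b‖) := by
  have hl := log_two_pos
  set R := C / Real.log 2 with hRdef
  have hR : 0 ≤ R := by positivity
  have hM : 0 ≤ M := (norm_nonneg T).trans hT
  have hn1 : (1 : ℝ) ≤ n := by exact_mod_cast hn
  have hnm' : (n : ℝ) ≤ m := by exact_mod_cast hnm
  have hm0 : (0 : ℝ) < m := by linarith
  set r := Real.sqrt n with hr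
  have hr1 : 1 ≤ r := Real.one_le_sqrt.2 hn1
  have hrn : (n : ℝ) = r ^ 2 := (Real.sq_sqrt (by positivity)).symm
  set a := (n : ℝ) / m - n / (m + 1) with ha
  have ha' : a = r ^ 2 / (m * (m + 1)) := by
    rw [ha, hrn]
    field_simp
    ring
  have ha0 : 0 ≤ a := by rw [ha']; positivity
  set q := M * R
  have hq : 0 ≤ q := by positivity
  have hTq : ‖T‖ * R ≤ q := mul_le_mul_of_nonneg_right hT hR
  set c := r / ((m : ℝ) + 1)
  have hc0 : 0 ≤ c := by positivity
  have hcr : c ≤ 1 / r := by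
    rw [div_le_div_iff₀ (by positivity) (by positivity)]
    nlinarith
  have hr1' : 1 / r ≤ 1 := by
    rw [div_le_one (by positivity)]
    exact hr1
  have hc1 : c ≤ 1 := hcr.trans hr1'
  have hca : c ^ 2 ≤ a := by
    rw [ha', div_pow]
    gcongr
    nlinarith
  have hac : a - c ^ 2 ≤ a * (1 / r) := by
    have h1 : a - c ^ 2 = a * (1 / ((m : ℝ) + 1)) := by
      rw [ha', div_pow]
      field_simp
      ring
    rw [h1]
    gcongr
    nlinarith
  have har : a ≤ 1 / r := by
    rw [ha', div_le_div_iff₀ (by positivity) (by positivity)]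
    have h1 : r ^ 2 * r ≤ m * r := by
      rw [← hrn]
      gcongr
    have h2 : m * r ≤ m * ((m : ℝ) + 1) := by
      gcongr
      nlinarith
    linarith
  have ha1 : a ≤ 1 := har.trans hr1'
  set u := fisher PX b T
  set w := fisher PX b' T
  have hu0 : 0 ≤ u := fisher_nonneg b T
  have huq : u ≤ q ^ 2 := by
    refine (fisher_le hC b T).trans ?_
    rw [← hRdef, ← mul_pow]
    gcongr
  have huw : |u - w| ≤ fisherConst C M * ‖b' - b‖ := by
    rw [fisherConst, norm_sub_rev]
    exact (abs_fisher_sub_le hC b b' T).trans (by gcongr)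
  have h1 : ‖∫ v, Complex.exp ((inner ℝ (c • T) v : ℝ) * Complex.I) ∂scoreLaw PX b' -
      (1 - ((c ^ 2 * w / 2 : ℝ) : ℂ))‖ ≤ a * (1 / r) * (q ^ 3 * Real.exp q) := by
    have hcT : ‖c • T‖ * R ≤ c * q := by
      rw [norm_smul, Real.norm_eq_abs, abs_of_nonneg hc0, mul_assoc]
      gcongr
    have := norm_integral_exp_scoreLaw_sub_le hC b' (c • T) hcT
    rw [fisher_smul] at this
    refine this.trans ?_
    have h2 : (c * q) ^ 3 * Real.exp (c * q) ≤ (c * q) ^ 3 * Real.exp q := by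
      gcongr
      exact mul_le_of_le_one_left hq hc1
    have h3 : c ^ 3 ≤ a * (1 / r) := by
      calc c ^ 3 = c ^ 2 * c := by ring
        _ ≤ a * (1 / r) := by gcongr
    calc _ ≤ (c * q) ^ 3 * Real.exp q := h2
      _ = c ^ 3 * (q ^ 3 * Real.exp q) := by ring
      _ ≤ _ := by gcongr
  have h2 : |1 - u * a / 2 - Real.exp (-(u * a) / 2)| ≤
      a * (1 / r) * (q ^ 4 * Real.exp (q ^ 2)) := by
    have hx : 0 ≤ u * a / 2 := by positivity
    have := Complex.norm_exp_sub_sum_le_norm_mul_exp ((-(u * a) / 2 : ℝ) : ℂ) 2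
    rw [← Complex.ofReal_exp] at this
    simp only [Finset.sum_range_succ, Finset.sum_range_zero, Nat.factorial, pow_zero, pow_one,
      zero_add] at this
    have e : (Real.exp (-(u * a) / 2) : ℂ) - (1 / ((1 : ℕ) : ℂ) +
        ((-(u * a) / 2 : ℝ) : ℂ) / (((0 + 1) * 1 : ℕ) : ℂ)) =
        ((-(1 - u * a / 2 - Real.exp (-(u * a) / 2)) : ℝ) : ℂ) := by
      push_cast
      ring
    simp only [zero_add] at e
    rw [e, Complex.norm_real, norm_neg, Real.norm_eq_abs, Complex.norm_real, Real.norm_eq_abs,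
      neg_div, abs_neg, abs_of_nonneg hx] at this
    rw [neg_div]
    refine this.trans ?_
    have h3 : u * a / 2 ≤ q ^ 2 * a := by nlinarith
    have h4 : u * a / 2 ≤ q ^ 2 := h3.trans (mul_le_of_le_one_right (by positivity) ha1)
    calc (u * a / 2) ^ 2 * Real.exp (u * a / 2) ≤ (q ^ 2 * a) ^ 2 * Real.exp (q ^ 2) := by gcongr
      _ = a * a * (q ^ 4 * Real.exp (q ^ 2)) := by ring
      _ ≤ _ := by gcongr
  have h3 : |u * a - c ^ 2 * w| ≤ a * (1 / r) * q ^ 2 + a * (fisherConst C M * ‖b' - b‖) := by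
    have e : u * a - c ^ 2 * w = u * (a - c ^ 2) + c ^ 2 * (u - w) := by ring
    rw [e]
    refine (abs_add_le _ _).trans (add_le_add ?_ ?_)
    · rw [abs_mul, abs_of_nonneg hu0, abs_of_nonneg (sub_nonneg.2 hca), mul_comm]
      gcongr
    · rw [abs_mul, abs_of_nonneg (sq_nonneg c)]
      gcongr
  set I := ∫ v, Complex.exp ((inner ℝ (c • T) v : ℝ) * Complex.I) ∂scoreLaw PX b'
  -- Three errors: expansion of the characteristic function (order c³), expansion of the Gaussian
  -- factor (order a²), and mismatch of the two variances.
  have e : I - (Real.exp (-(u * a) / 2) : ℂ) = (I - (1 - ((c ^ 2 * w / 2 : ℝ) : ℂ))) +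
      ((1 - u * a / 2 - Real.exp (-(u * a) / 2) : ℝ) : ℂ) +
      (((u * a - c ^ 2 * w) / 2 : ℝ) : ℂ) := by
    push_cast
    ring
  rw [e]
  refine (norm_add₃_le).trans ?_
  rw [Complex.norm_real, Complex.norm_real, Real.norm_eq_abs, Real.norm_eq_abs]
  have h4 : |(u * a - c ^ 2 * w) / 2| ≤ |u * a - c ^ 2 * w| := by
    rw [abs_div, abs_two]
    exact half_le_self (abs_nonneg _)
  refine (add_le_add (add_le_add h1 h2) (h4.trans h3)).trans_eq ?_
  rw [taylorConst]
  ring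

/-- The constant in the bound of the conditional central limit theorem. -/
noncomputable def cltConst (C M : ℝ) : ℝ :=
  taylorConst (M * (C / Real.log 2)) + fisherConst C M * ((C / Real.log 2) ^ 2 + 1)

/-- The product of `exp (i ⟨T, √n (β_m - β_n)⟩)` and of the value at `√(n / m) T` of the
characteristic function of the centred normal distribution with covariance `U(β_n)`. -/
noncomputable def interp (PX : Measure (Vec d)) (β : ℕ → Ω → Vec d)
    (T : Ω → Vec d) (n m : ℕ) (ω : Ω) : ℂ :=
  Complex.exp ((Real.sqrt n * inner ℝ (T ω) (β m ω - β n ω) : ℝ) * Complex.I) *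
    (Real.exp (-(fisher PX (β n ω) (T ω) * (n / m)) / 2) : ℂ)

theorem norm_exp_neg_fisher_le (PX : Measure (Vec d)) (b t : Vec d) {c : ℝ} (hc : 0 ≤ c) :
    ‖(Real.exp (-(fisher PX b t * c) / 2) : ℂ)‖ ≤ 1 := by
  rw [Complex.norm_real, Real.norm_eq_abs, Real.abs_exp, Real.exp_le_one_iff]
  have := mul_nonneg (fisher_nonneg (PX := PX) b t) hc
  linarith

theorem norm_interp_le (PX : Measure (Vec d)) (β : ℕ → Ω → Vec d)
    (T : Ω → Vec d) (n m : ℕ) (ω : Ω) : ‖interp PX β T n m ω‖ ≤ 1 := by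
  rw [interp, norm_mul, Complex.norm_exp_ofReal_mul_I, one_mul]
  exact norm_exp_neg_fisher_le PX _ _ (by positivity)

namespace IsOnlineModel

variable [MeasurableSpace Ω] {P : Measure Ω} [IsProbabilityMeasure P] {PX : Measure (Vec d)}
  [IsProbabilityMeasure PX] {b₀ : Ω → Vec d} {X : ℕ → Ω → Vec d} {Y : ℕ → Ω → Fin 2} {C : ℝ}

omit [MeasurableSpace Ω] in
theorem measurable_exp_fisher (n : ℕ) {T : Ω → Vec d}
    (hT : Measurable[histSigma b₀ X Y n] T) (c : ℝ) :
    Measurable[histSigma b₀ X Y n]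
      fun ω => (Real.exp (-(fisher PX (beta b₀ X Y n ω) (T ω) * c) / 2) : ℂ) := by
  have h : Measurable fun p : Vec d × Vec d => (Real.exp (-(fisher PX p.1 p.2 * c) / 2) : ℂ) :=
    Complex.measurable_ofReal.comp (Real.measurable_exp.comp
      (((measurable_fisher PX).mul_const c).neg.div_const 2))
  exact Measurable.comp (f := fun ω => (beta b₀ X Y n ω, T ω)) h
    ((measurable_histSigma_beta b₀ X Y n).prodMk hT)

omit [MeasurableSpace Ω] in
theorem measurable_exp_inner (n k : ℕ) {T : Ω → Vec d}
    (hT : Measurable[histSigma b₀ X Y n] T) (c : ℝ) :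
    Measurable[histSigma b₀ X Y (n + k)] fun ω => Complex.exp
      ((c * inner ℝ (T ω) (beta b₀ X Y (n + k) ω - beta b₀ X Y n ω) : ℝ) * Complex.I) := by
  have h : Measurable fun p : Vec d × Vec d => Complex.exp
      ((c * inner ℝ p.1 p.2 : ℝ) * Complex.I) := Continuous.measurable (by fun_prop)
  exact Measurable.comp
    (f := fun ω => (T ω, beta b₀ X Y (n + k) ω - beta b₀ X Y n ω)) h
    ((hT.mono (histSigma_mono b₀ X Y (Nat.le_add_right n k)) le_rfl).prodMk
    ((measurable_histSigma_beta b₀ X Y (n + k)).sub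
      (measurable_histSigma_beta_le b₀ X Y (Nat.le_add_right n k))))

omit [IsProbabilityMeasure P] in
theorem measurable_interp (hM : IsOnlineModel P PX b₀ X Y C) (n k : ℕ) {T : Ω → Vec d}
    (hT : Measurable[histSigma b₀ X Y n] T) :
    Measurable (interp PX (beta b₀ X Y) T n (n + k)) :=
  ((measurable_exp_inner n k hT _).mono (hM.histSigma_le _) le_rfl).mul
    ((measurable_exp_fisher n hT _).mono (hM.histSigma_le _) le_rfl)

theorem integrable_interp (hM : IsOnlineModel P PX b₀ X Y C) (n k : ℕ) {T : Ω → Vec d}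
    (hT : Measurable[histSigma b₀ X Y n] T) :
    Integrable (interp PX (beta b₀ X Y) T n (n + k)) P :=
  Integrable.of_bound (hM.measurable_interp n k hT).aestronglyMeasurable 1
    (ae_of_all _ fun _ => norm_interp_le _ _ _ _ _ _)

/-- The increment is a factor known at time m times a function of the next score, so integrating
that score out reduces it to `norm_integral_exp_sub_exp_le`; the drift β_m - β_n is then averaged
over B. -/
theorem norm_setIntegral_interp_succ_sub_le (hM : IsOnlineModel P PX b₀ X Y C) {n : ℕ}
    (hn : 1 ≤ n) (k : ℕ) {T : Ω → Vec d} (hT : Measurable[histSigma b₀ X Y n] T) {M : ℝ}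
    (hTM : ∀ ω, ‖T ω‖ ≤ M) {B : Set Ω} (hB : MeasurableSet[histSigma b₀ X Y n] B) :
    ‖∫ ω in B, (interp PX (beta b₀ X Y) T n (n + k + 1) ω -
        interp PX (beta b₀ X Y) T n (n + k) ω) ∂P‖ ≤
      ((n : ℝ) / ((n + k : ℕ) : ℝ) - n / (((n + k : ℕ) : ℝ) + 1)) *
        (cltConst C M / Real.sqrt n * P.real B) := by
  set m := n + k with hm
  have hmono : histSigma b₀ X Y n ≤ histSigma b₀ X Y m :=
    histSigma_mono b₀ X Y (Nat.le_add_right n k)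
  have hBm : MeasurableSet B := hM.histSigma_le n _ hB
  set a : ℝ := (n : ℝ) / m - n / (m + 1) with ha
  have hm0 : (0 : ℝ) < m := by
    have : 0 < m := by omega
    exact_mod_cast this
  have ha0 : 0 ≤ a := by
    rw [ha, sub_nonneg]
    gcongr
    linarith
  -- The common factor of both terms has n/(m+1), not n/m, in the Gaussian part; the missing piece
  -- exp(-a · fisher / 2) of the earlier term is `c`.
  set Z : Ω → ℂ := B.indicator fun ω =>
    Complex.exp ((Real.sqrt n * inner ℝ (T ω) (beta b₀ X Y m ω - beta b₀ X Y n ω) : ℝ) * Complex.I) *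
      (Real.exp (-(fisher PX (beta b₀ X Y n ω) (T ω) * (n / (m + 1))) / 2) : ℂ) with hZ
  set c : Ω → ℂ := fun ω => (Real.exp (-(fisher PX (beta b₀ X Y n ω) (T ω) * a) / 2) : ℂ)
  set t : Ω → Vec d := fun ω => (Real.sqrt n / (m + 1)) • T ω
  have hZm : Measurable[histSigma b₀ X Y m] Z :=
    ((measurable_exp_inner n k hT _).mul ((measurable_exp_fisher n hT _).mono hmono le_rfl)).indicator
      (hmono _ hB)
  have htm : Measurable[histSigma b₀ X Y m] t := (hT.mono hmono le_rfl).const_smul (Real.sqrt n / (m + 1))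
  have hcm : Measurable[histSigma b₀ X Y m] c := (measurable_exp_fisher n hT _).mono hmono le_rfl
  have hZ1 : ∀ ω, ‖Z ω‖ ≤ B.indicator (fun _ => (1 : ℝ)) ω := fun ω => by
    by_cases hω : ω ∈ B
    · simp only [hZ, hω, Set.indicator_of_mem]
      rw [norm_mul, Complex.norm_exp_ofReal_mul_I, one_mul]
      exact norm_exp_neg_fisher_le PX _ _ (by positivity)
    · simp [hZ, hω]
  have hZ2 : ∀ ω, ‖Z ω‖ ≤ 1 := fun ω => (hZ1 ω).trans (Set.indicator_le_self' (by simp) _)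
  have hc1 : ∀ ω, ‖c ω‖ ≤ 1 := fun ω => norm_exp_neg_fisher_le PX _ _ ha0
  have hnext := hM.integral_next_score m (h := fun ω => (Z ω, t ω, c ω))
    (hZm.prodMk (htm.prodMk hcm))
    (Φ := fun p v => p.1 * (Complex.exp ((inner ℝ p.2.1 v : ℝ) * Complex.I) - p.2.2))
    (Continuous.stronglyMeasurable (by fun_prop)) (K := 1 * (1 + 1))
    (ae_of_all _ fun ω v _ => by
      rw [norm_mul]
      have h1 := hZ2 ω
      have h2 := hc1 ω
      gcongr
      refine (norm_sub_le _ _).trans ?_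
      rw [Complex.norm_exp_ofReal_mul_I]
      gcongr)
  have hstep : ∀ ω, B.indicator (fun ω => interp PX (beta b₀ X Y) T n (m + 1) ω -
        interp PX (beta b₀ X Y) T n m ω) ω =
      Z ω * (Complex.exp ((inner ℝ (t ω)
        (score (Y (m + 1) ω) (X (m + 1) ω) (beta b₀ X Y m ω)) : ℝ) * Complex.I) - c ω) := fun ω => by
    by_cases hω : ω ∈ B
    · simp only [hZ, hω, Set.indicator_of_mem, interp, c, t]
      rw [mul_sub, mul_right_comm, ← Complex.exp_add, mul_assoc _ (Complex.ofReal _) (Complex.ofReal _),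
        ← Complex.ofReal_mul, ← Real.exp_add, beta_succ]
      congr 3
      · rw [← add_mul, ← Complex.ofReal_add, add_sub_right_comm, inner_add_right, inner_smul_right,
          real_inner_smul_left]
        congr 2
        ring
      · push_cast
        rfl
      · congr 1
        rw [ha]
        ring
    · simp [hZ, hω]
  rw [← integral_indicator hBm]
  simp_rw [hstep]
  rw [hnext]
  have hpt : ∀ ω, ‖∫ v, Z ω * (Complex.exp ((inner ℝ (t ω) v : ℝ) * Complex.I) - c ω)
        ∂scoreLaw PX (beta b₀ X Y m ω)‖ ≤
      B.indicator (fun ω => a * (taylorConst (M * (C / Real.log 2)) / Real.sqrt n +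
        fisherConst C M * ‖beta b₀ X Y m ω - beta b₀ X Y n ω‖)) ω := fun ω => by
    have hi : Integrable (fun v => Complex.exp ((inner ℝ (t ω) v : ℝ) * Complex.I))
        (scoreLaw PX (beta b₀ X Y m ω)) :=
      Integrable.of_bound (Continuous.aestronglyMeasurable (by fun_prop)) 1
        (ae_of_all _ fun v => (Complex.norm_exp_ofReal_mul_I _).le)
    rw [integral_const_mul, integral_sub hi (integrable_const _), integral_const, probReal_univ,
      one_smul, norm_mul]
    have h1 := norm_integral_exp_sub_exp_le hM.feature_le hM.bound_nonneg (b := beta b₀ X Y n ω)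
      (b' := beta b₀ X Y m ω) (hTM ω) hn (Nat.le_add_right n k)
    have h2 := mul_le_mul (hZ1 ω) h1 (norm_nonneg _) (Set.indicator_nonneg (by simp) _)
    refine h2.trans_eq ?_
    by_cases hω : ω ∈ B
    · simp only [hω, Set.indicator_of_mem, one_mul]
      rfl
    · simp [hω]
  have hint : IntegrableOn (fun ω => a * (taylorConst (M * (C / Real.log 2)) / Real.sqrt n +
      fisherConst C M * ‖beta b₀ X Y m ω - beta b₀ X Y n ω‖)) B P :=
    (((integrable_const _).add ((hM.integrable_norm_beta_sub n k).const_mul _)).const_mul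
      a).integrableOn
  refine (norm_integral_le_of_norm_le ((integrable_indicator_iff hBm).2 hint)
    (ae_of_all _ hpt)).trans ?_
  rw [integral_indicator hBm, integral_const_mul,
    integral_add (integrable_const _)
      ((hM.integrable_norm_beta_sub n k).const_mul _).integrableOn,
    integral_const_mul, setIntegral_const, smul_eq_mul]
  have h3 := hM.setIntegral_norm_beta_sub_le hn k hB
  have h4 : 0 ≤ fisherConst C M := by
    have := hM.bound_nonneg
    unfold fisherConst
    positivity
  refine (mul_le_mul_of_nonneg_left (add_le_add_right (mul_le_mul_of_nonneg_left h3 h4) _)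
    ha0).trans_eq ?_
  rw [cltConst]
  ring

/-- The step weights n/m - n/(m+1) telescope, so the error stays bounded uniformly in k. -/
theorem norm_setIntegral_interp_sub_le (hM : IsOnlineModel P PX b₀ X Y C) {n : ℕ}
    (hn : 1 ≤ n) (k : ℕ) {T : Ω → Vec d} (hT : Measurable[histSigma b₀ X Y n] T) {M : ℝ}
    (hTM : ∀ ω, ‖T ω‖ ≤ M) {B : Set Ω} (hB : MeasurableSet[histSigma b₀ X Y n] B) :
    ‖∫ ω in B, (interp PX (beta b₀ X Y) T n (n + k) ω -
        interp PX (beta b₀ X Y) T n n ω) ∂P‖ ≤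
      (1 - n / ((n + k : ℕ) : ℝ)) * (cltConst C M / Real.sqrt n * P.real B) := by
  have hn0 : (n : ℝ) ≠ 0 := by positivity
  induction k with
  | zero => simp [hn0]
  | succ k ih =>
    have hi : ∀ j, IntegrableOn (interp PX (beta b₀ X Y) T n (n + j)) B P := fun j =>
      (hM.integrable_interp n j hT).integrableOn
    have e : ∫ ω in B, (interp PX (beta b₀ X Y) T n (n + (k + 1)) ω -
        interp PX (beta b₀ X Y) T n n ω) ∂P =
        ∫ ω in B, (interp PX (beta b₀ X Y) T n (n + k + 1) ω -
          interp PX (beta b₀ X Y) T n (n + k) ω) ∂P +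
        ∫ ω in B, (interp PX (beta b₀ X Y) T n (n + k) ω -
          interp PX (beta b₀ X Y) T n n ω) ∂P := by
      have h0 : IntegrableOn (interp PX (beta b₀ X Y) T n n) B P := hi 0
      have h1 : IntegrableOn (interp PX (beta b₀ X Y) T n (n + k + 1)) B P := hi (k + 1)
      rw [← add_assoc, integral_sub h1 h0, integral_sub h1 (hi k), integral_sub (hi k) h0]
      ring
    rw [e]
    refine (norm_add_le _ _).trans ((add_le_add
      (hM.norm_setIntegral_interp_succ_sub_le hn k hT hTM hB) ih).trans_eq ?_)
    push_cast
    ring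

theorem cltConst_nonneg (hC : 0 ≤ C) {M : ℝ} (hM : 0 ≤ M) : 0 ≤ cltConst C M := by
  have := log_two_pos
  unfold cltConst taylorConst fisherConst
  positivity

/-- The conditional central limit theorem with rate, in integrated form. -/
theorem norm_setIntegral_exp_sub_le (hM : IsOnlineModel P PX b₀ X Y C) {βlim : Ω → Vec d}
    (hβ : ∀ᵐ ω ∂P, Tendsto (fun n => beta b₀ X Y n ω) atTop (𝓝 (βlim ω))) {n : ℕ}
    (hn : 1 ≤ n) {T : Ω → Vec d} (hT : Measurable[histSigma b₀ X Y n] T) {M : ℝ} (hM0 : 0 ≤ M)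
    (hTM : ∀ ω, ‖T ω‖ ≤ M) {B : Set Ω} (hB : MeasurableSet[histSigma b₀ X Y n] B) :
    ‖∫ ω in B, (Complex.exp ((Real.sqrt n * inner ℝ (T ω) (βlim ω - beta b₀ X Y n ω) : ℝ) *
        Complex.I) - (Real.exp (-fisher PX (beta b₀ X Y n ω) (T ω) / 2) : ℂ)) ∂P‖ ≤
      cltConst C M / Real.sqrt n * P.real B := by
  have hn0 : (n : ℝ) ≠ 0 := by positivity
  -- As k → ∞ the Gaussian factor tends to 1 since n/(n+k) → 0; at k = 0 the oscillating factor is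
  -- 1.
  have hlim : Tendsto (fun k => ∫ ω in B, (interp PX (beta b₀ X Y) T n (n + k) ω -
        interp PX (beta b₀ X Y) T n n ω) ∂P) atTop
      (𝓝 (∫ ω in B, (Complex.exp ((Real.sqrt n * inner ℝ (T ω) (βlim ω - beta b₀ X Y n ω) : ℝ) *
        Complex.I) - (Real.exp (-fisher PX (beta b₀ X Y n ω) (T ω) / 2) : ℂ)) ∂P)) := by
    refine tendsto_integral_of_dominated_convergence (fun _ => 1 + 1) (fun k => ?_)
      (integrable_const _) (fun k => ae_of_all _ fun ω => ?_) ?_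
    · exact ((hM.measurable_interp n k hT).sub (hM.measurable_interp n 0 hT)).aestronglyMeasurable
    · exact (norm_sub_le _ _).trans (add_le_add (norm_interp_le _ _ _ _ _ _)
        (norm_interp_le _ _ _ _ _ _))
    · filter_upwards [ae_restrict_of_ae hβ] with ω hω
      have h1 : Tendsto (fun k => beta b₀ X Y (n + k) ω) atTop (𝓝 (βlim ω)) := by
        simp_rw [add_comm n]
        exact (tendsto_add_atTop_iff_nat n).2 hω
      have h2 : Tendsto (fun k : ℕ => (n : ℝ) / ((n + k : ℕ) : ℝ)) atTop (𝓝 0) := by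
        simp_rw [add_comm n]
        exact (tendsto_add_atTop_iff_nat (f := fun k : ℕ => (n : ℝ) / (k : ℝ)) n).2
          (tendsto_const_div_atTop_nhds_zero_nat _)
      have h3 : Tendsto (fun k => interp PX (beta b₀ X Y) T n (n + k) ω) atTop
          (𝓝 (Complex.exp ((Real.sqrt n * inner ℝ (T ω) (βlim ω - beta b₀ X Y n ω) : ℝ) *
            Complex.I) * (Real.exp (-(fisher PX (beta b₀ X Y n ω) (T ω) * 0) / 2) : ℂ))) := by
        refine Tendsto.mul ?_ ?_
        · have hc : Continuous fun b : Vec d => Complex.exp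
              ((Real.sqrt n * inner ℝ (T ω) (b - beta b₀ X Y n ω) : ℝ) * Complex.I) := by
            fun_prop
          exact (hc.tendsto _).comp h1
        · have hc : Continuous fun x : ℝ =>
              (Real.exp (-(fisher PX (beta b₀ X Y n ω) (T ω) * x) / 2) : ℂ) := by
            fun_prop
          exact (hc.tendsto _).comp h2
      have h4 : interp PX (beta b₀ X Y) T n n ω =
          (Real.exp (-fisher PX (beta b₀ X Y n ω) (T ω) / 2) : ℂ) := by
        simp [interp, hn0]
      rw [← h4]
      simpa using h3.sub_const (interp PX (beta b₀ X Y) T n n ω)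
  refine le_of_tendsto hlim.norm (Eventually.of_forall fun k => ?_)
  refine (hM.norm_setIntegral_interp_sub_le hn k hT hTM hB).trans
    (mul_le_of_le_one_left ?_ ?_)
  · have := cltConst_nonneg hM.bound_nonneg hM0
    positivity
  · have : (0 : ℝ) ≤ n / ((n + k : ℕ) : ℝ) := by positivity
    linarith

end IsOnlineModel

/-! ### The inverse square root -/

section InvSqrt

open scoped Matrix.Norms.L2Operator in
-- The operator norm supplies the C⋆-algebra structure behind continuity of the functional calculus.
theorem continuousOn_matrix_sqrt :
    ContinuousOn (CFC.sqrt : Matrix (Fin d) (Fin d) ℝ → _) {M | 0 ≤ M} :=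
  CFC.continuousOn_sqrt

theorem isHermitian_sqrt (M : Matrix (Fin d) (Fin d) ℝ) : (CFC.sqrt M).IsHermitian :=
  (Matrix.nonneg_iff_posSemidef.1 (CFC.sqrt_nonneg M)).isHermitian

theorem isHermitian_invSqrt (M : Matrix (Fin d) (Fin d) ℝ) : (invSqrt M).IsHermitian :=
  (isHermitian_sqrt M).inv

theorem inner_toEuclideanCLM_comm {M : Matrix (Fin d) (Fin d) ℝ} (hM : M.IsHermitian)
    (x y : Vec d) : inner ℝ (Matrix.toEuclideanCLM (𝕜 := ℝ) M x) y =
      inner ℝ x (Matrix.toEuclideanCLM (𝕜 := ℝ) M y) := by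
  have h : star (Matrix.toEuclideanCLM (𝕜 := ℝ) M) = Matrix.toEuclideanCLM (𝕜 := ℝ) M := by
    rw [← map_star, Matrix.star_eq_conjTranspose, hM.eq]
  rw [← ContinuousLinearMap.adjoint_inner_right, ← ContinuousLinearMap.star_eq_adjoint, h]

theorem continuous_toEuclideanCLM_apply :
    Continuous fun p : Matrix (Fin d) (Fin d) ℝ × Vec d =>
      Matrix.toEuclideanCLM (𝕜 := ℝ) p.1 p.2 := by
  have h : (fun p : Matrix (Fin d) (Fin d) ℝ × Vec d =>
      Matrix.toEuclideanCLM (𝕜 := ℝ) p.1 p.2) =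
      fun p => WithLp.toLp 2 (p.1.mulVec p.2.ofLp) := by
    ext1 p
    rw [← Matrix.ofLp_toEuclideanCLM]
  rw [h]
  refine (PiLp.continuous_toLp 2 _).comp (Continuous.matrix_mulVec continuous_fst ?_)
  exact (PiLp.continuous_ofLp 2 _).comp continuous_snd

/-- The approximating matrices may be singular; only the limit has to be invertible, since inversion
is continuous there. -/
theorem tendsto_invSqrt {ι : Type*} {l : Filter ι} {V : ι → Matrix (Fin d) (Fin d) ℝ}
    {U : Matrix (Fin d) (Fin d) ℝ} (hV : ∀ i, (V i).PosSemidef) (hU : U.PosDef)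
    (h : Tendsto V l (𝓝 U)) : Tendsto (fun i => invSqrt (V i)) l (𝓝 (invSqrt U)) := by
  have hU0 : 0 ≤ U := Matrix.nonneg_iff_posSemidef.2 hU.posSemidef
  have h1 : Tendsto (fun i => CFC.sqrt (V i)) l (𝓝 (CFC.sqrt U)) :=
    (continuousOn_matrix_sqrt U hU0).tendsto.comp
      (tendsto_nhdsWithin_iff.2 ⟨h, Eventually.of_forall fun i =>
        Matrix.nonneg_iff_posSemidef.2 (hV i)⟩)
  have hdet : (CFC.sqrt U).det ≠ 0 := fun h0 => by
    have h2 := congrArg Matrix.det (CFC.sqrt_mul_sqrt_self U hU0)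
    rw [Matrix.det_mul, h0, mul_zero] at h2
    exact hU.det_pos.ne h2
  have h3 : ContinuousAt Ring.inverse (CFC.sqrt U).det := by
    rw [Ring.inverse_eq_inv']
    exact continuousAt_inv₀ hdet
  exact (continuousAt_matrix_inv _ h3).tendsto.comp h1

/-- From U^(-1/2) U U^(-1/2) = 1; this is what makes the limit law standard. -/
theorem inner_invSqrt_self {U : Matrix (Fin d) (Fin d) ℝ} (hU : U.PosDef) (t : Vec d) :
    inner ℝ (Matrix.toEuclideanCLM (𝕜 := ℝ) (invSqrt U) t)
      (Matrix.toEuclideanCLM (𝕜 := ℝ) U (Matrix.toEuclideanCLM (𝕜 := ℝ) (invSqrt U) t)) =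
      ‖t‖ ^ 2 := by
  have hU0 : 0 ≤ U := Matrix.nonneg_iff_posSemidef.2 hU.posSemidef
  have h1 := CFC.sqrt_mul_sqrt_self U hU0
  have hdet : IsUnit (CFC.sqrt U).det := by
    refine isUnit_iff_ne_zero.2 fun h0 => ?_
    have h2 := congrArg Matrix.det h1
    rw [Matrix.det_mul, h0, mul_zero] at h2
    exact hU.det_pos.ne h2
  have h2 : invSqrt U * (U * invSqrt U) = 1 := by
    rw [invSqrt]
    nth_rw 2 [← h1]
    rw [mul_assoc, Matrix.mul_nonsing_inv _ hdet, mul_one, Matrix.nonsing_inv_mul _ hdet]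
  rw [inner_toEuclideanCLM_comm (isHermitian_invSqrt U), ← mul_apply_eq_comp,
    ← mul_apply_eq_comp, ← map_mul, ← map_mul, mul_assoc, h2, map_one,
    one_apply_eq_self, real_inner_self_eq_norm_sq]

theorem measurable_invSqrt_apply {m : MeasurableSpace Ω} {V : Ω → Matrix (Fin d) (Fin d) ℝ}
    (hV : ∀ ω, (V ω).PosSemidef) (hm : ∀ i j, Measurable fun ω => V ω i j) (t : Vec d) :
    Measurable fun ω => Matrix.toEuclideanCLM (𝕜 := ℝ) (invSqrt (V ω)) t := by
  let : MeasurableSpace (Matrix (Fin d) (Fin d) ℝ) :=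
    (inferInstance : MeasurableSpace (Fin d → Fin d → ℝ))
  have : BorelSpace (Matrix (Fin d) (Fin d) ℝ) :=
    (inferInstance : BorelSpace (Fin d → Fin d → ℝ))
  have hVm : Measurable V := measurable_pi_iff.2 fun i => measurable_pi_iff.2 fun j => hm i j
  have hS : Measurable fun ω => CFC.sqrt (V ω) := by
    have h1 := (continuousOn_iff_continuous_domRestrict.1
      (continuousOn_matrix_sqrt (d := d))).measurable
    exact Measurable.comp (f := fun ω => (⟨V ω, Matrix.nonneg_iff_posSemidef.2 (hV ω)⟩ :
      {M : Matrix (Fin d) (Fin d) ℝ | 0 ≤ M})) h1 (hVm.subtype_mk)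
  -- Cramer's formula holds at singular matrices as well, with the convention 0⁻¹ = 0, so no case
  -- distinction is needed.
  have hI : Measurable fun M : Matrix (Fin d) (Fin d) ℝ => M⁻¹ := by
    refine measurable_pi_iff.2 fun i => measurable_pi_iff.2 fun j => ?_
    simp only [Matrix.inv_def, Ring.inverse_eq_inv', Matrix.smul_apply, smul_eq_mul]
    have h1 : Continuous fun M : Matrix (Fin d) (Fin d) ℝ => M.det :=
      continuous_id.matrix_det
    have h2 : Continuous fun M : Matrix (Fin d) (Fin d) ℝ => M.adjugate i j :=
      continuous_id.matrix_adjugate.matrix_elem i j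
    exact h1.measurable.inv.mul h2.measurable
  have hc : Continuous fun M : Matrix (Fin d) (Fin d) ℝ => Matrix.toEuclideanCLM (𝕜 := ℝ) M t :=
    Continuous.comp (f := fun M : Matrix (Fin d) (Fin d) ℝ => (M, t))
      continuous_toEuclideanCLM_apply (by fun_prop)
  exact hc.measurable.comp (hI.comp hS)

end InvSqrt

/-! ### Positivity of `V_n` and of its limit -/

theorem posSemidef_V (b₀ : Ω → Vec d) (X : ℕ → Ω → Vec d) (Y : ℕ → Ω → Fin 2) (n : ℕ) (ω : Ω) :
    (V b₀ X Y n ω).PosSemidef := by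
  refine Matrix.PosSemidef.smul (Matrix.posSemidef_sum _ fun k _ => ?_) (by positivity)
  refine Matrix.PosSemidef.smul ?_ (by positivity)
  simpa using Matrix.posSemidef_vecMulVec_self_star
    (fun i => beta b₀ X Y k ω i - beta b₀ X Y (k - 1) ω i)

/-- Since g(1 - g) > 0, a vanishing quadratic form at t ≠ 0 would force ⟨t, x⟩ = 0 almost surely and
put all the mass of `PX` on the proper subspace orthogonal to t. -/
theorem posDef_U {PX : Measure (Vec d)} [IsProbabilityMeasure PX] {C : ℝ}
    (hC : ∀ᵐ x ∂PX, ‖x‖ ≤ C)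
    (hnondeg : ∀ S : Submodule ℝ (Vec d), S ≠ ⊤ → PX (S : Set (Vec d)) < 1) (b : Vec d) :
    (U PX b).PosDef := by
  have hherm : (U PX b).IsHermitian := by
    ext i j
    simp only [Matrix.conjTranspose_apply, U, Matrix.of_apply, star_trivial, mul_comm]
  refine Matrix.PosDef.of_dotProduct_mulVec_pos hherm fun x hx => ?_
  set t : Vec d := WithLp.toLp 2 x
  have ht : t ≠ 0 := fun h => hx (by simpa [t] using congrArg WithLp.ofLp h)
  have e : star x ⬝ᵥ (U PX b).mulVec x = fisher PX b t := by
    rw [← inner_toEuclideanCLM_U hC, PiLp.inner_apply, dotProduct]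
    refine Finset.sum_congr rfl fun i _ => ?_
    simp [t, mul_comm]
  rw [e]
  refine (fisher_nonneg b t).lt_of_ne' fun h0 => ?_
  have hl := log_two_pos
  have h1 : ∫ x, inner ℝ t x ^ 2 * (g x b * (1 - g x b)) ∂PX = 0 := by
    rw [fisher] at h0
    exact (mul_eq_zero.1 h0).resolve_left (by positivity)
  rw [integral_eq_zero_iff_of_nonneg
    (fun x => mul_nonneg (sq_nonneg _) (g_mul_pos x b).le) (integrable_fisher hC b t)] at h1
  have h2 : ∀ᵐ x ∂PX, x ∈ ((ℝ ∙ t)ᗮ : Submodule ℝ (Vec d)) := by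
    filter_upwards [h1] with x hx
    rw [Submodule.mem_orthogonal_singleton_iff_inner_right]
    simpa [(g_mul_pos x b).ne', (g_pos x b).ne', (sub_pos.2 (g_lt_one x b)).ne'] using hx
  have h3 : (ℝ ∙ t)ᗮ ≠ (⊤ : Submodule ℝ (Vec d)) := fun h => by
    have : t ∈ (ℝ ∙ t)ᗮ := h ▸ Submodule.mem_top
    rw [Submodule.mem_orthogonal_singleton_iff_inner_right, inner_self_eq_zero] at this
    exact ht this
  exact (hnondeg _ h3).ne
    ((prob_compl_eq_zero_iff (Submodule.closed_of_finiteDimensional _).measurableSet).1 h2)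

/-! ### Characteristic functions of the conditional laws -/

theorem ae_le_of_forall_setIntegral_le_mul {m m0 : MeasurableSpace Ω} {P : Measure Ω}
    [IsFiniteMeasure P] (hm : m ≤ m0) {f : Ω → ℝ} (hf : StronglyMeasurable[m] f)
    (hfi : Integrable f P) {c : ℝ}
    (h : ∀ B, MeasurableSet[m] B → ∫ ω in B, f ω ∂P ≤ c * P.real B) : ∀ᵐ ω ∂P, f ω ≤ c := by
  refine ae_of_ae_trim hm (ae_le_of_forall_setIntegral_le (hfi.trim hm hf) (integrable_const c)
    fun B hB _ => ?_)
  rw [← setIntegral_trim hm hf hB, setIntegral_const, smul_eq_mul, mul_comm, measureReal_def,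
    trim_measurableSet_eq hm hB]
  exact h B hB

/-- Testing with ±re and ±im reduces to the real case; bounding the two parts separately costs the
factor 2. -/
theorem ae_norm_le_of_forall_norm_setIntegral_le {m m0 : MeasurableSpace Ω} {P : Measure Ω}
    [IsFiniteMeasure P] (hm : m ≤ m0) {f : Ω → ℂ} (hf : StronglyMeasurable[m] f)
    (hfi : Integrable f P) {c : ℝ}
    (h : ∀ B, MeasurableSet[m] B → ‖∫ ω in B, f ω ∂P‖ ≤ c * P.real B) :
    ∀ᵐ ω ∂P, ‖f ω‖ ≤ 2 * c := by
  have key : ∀ L : ℂ →L[ℝ] ℝ, (∀ z, L z ≤ ‖z‖) → ∀ᵐ ω ∂P, L (f ω) ≤ c := fun L hL =>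
    ae_le_of_forall_setIntegral_le_mul hm (L.continuous.comp_stronglyMeasurable hf)
      (L.integrable_comp hfi) fun B hB => by
        rw [L.integral_comp_comm hfi.integrableOn]
        exact (hL _).trans (h B hB)
  filter_upwards [key Complex.reCLM fun z => Complex.re_le_norm z,
    key (-Complex.reCLM) fun z => (neg_le_abs _).trans (Complex.abs_re_le_norm z),
    key Complex.imCLM fun z => (le_abs_self _).trans (Complex.abs_im_le_norm z),
    key (-Complex.imCLM) fun z => (neg_le_abs _).trans (Complex.abs_im_le_norm z)]
    with ω h1 h2 h3 h4
  refine (Complex.norm_le_abs_re_add_abs_im _).trans ?_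
  have h5 : |(f ω).re| ≤ c := abs_le'.2 ⟨h1, h2⟩
  have h6 : |(f ω).im| ≤ c := abs_le'.2 ⟨h3, h4⟩
  linarith

namespace IsOnlineModel

variable [MeasurableSpace Ω] {P : Measure Ω} [IsProbabilityMeasure P] {PX : Measure (Vec d)}
  [IsProbabilityMeasure PX] {b₀ : Ω → Vec d} {X : ℕ → Ω → Vec d} {Y : ℕ → Ω → Fin 2} {C : ℝ}

omit [MeasurableSpace Ω] in
theorem measurable_histSigma_invSqrt_V (n : ℕ) (t : Vec d) : Measurable[histSigma b₀ X Y n]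
    fun ω => Matrix.toEuclideanCLM (𝕜 := ℝ) (invSqrt (V b₀ X Y n ω)) t := by
  refine measurable_invSqrt_apply (posSemidef_V b₀ X Y n) (fun i j => ?_) t
  simp only [V_apply_eq_sum]
  refine Measurable.const_mul (Finset.measurable_fun_sum _ fun k hk => ?_) _
  have hs : Measurable[histSigma b₀ X Y n]
      fun ω => score (Y (k + 1) ω) (X (k + 1) ω) (beta b₀ X Y k ω) :=
    (measurable_histSigma_score b₀ X Y (measurable_histSigma_beta b₀ X Y k)).mono
      (histSigma_mono b₀ X Y (Finset.mem_range.1 hk)) le_rfl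
  have hc : ∀ i, Measurable fun v : Vec d => v i := fun i => by fun_prop
  exact ((hc i).comp hs).mul ((hc j).comp hs)

omit [MeasurableSpace Ω] in
-- Symmetry moves V_n^(-1/2) onto t, which produces the history-measurable direction T of the
-- central limit bound.
theorem inner_stdError (b₀ : Ω → Vec d) (X : ℕ → Ω → Vec d) (Y : ℕ → Ω → Fin 2)
    (βlim : Ω → Vec d) (n : ℕ) (t : Vec d) (ω : Ω) :
    inner ℝ (stdError b₀ X Y βlim n ω) t = Real.sqrt n *
      inner ℝ (Matrix.toEuclideanCLM (𝕜 := ℝ) (invSqrt (V b₀ X Y n ω)) t)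
        (βlim ω - beta b₀ X Y n ω) := by
  rw [stdError, real_inner_smul_left, inner_toEuclideanCLM_comm (isHermitian_invSqrt _),
    real_inner_comm]

omit [IsProbabilityMeasure P] [IsProbabilityMeasure PX] in
theorem aemeasurable_stdError (hM : IsOnlineModel P PX b₀ X Y C) {βlim : Ω → Vec d}
    (hβ : AEMeasurable βlim P) (n : ℕ) : AEMeasurable (stdError b₀ X Y βlim n) P := by
  have h : ∀ i, AEMeasurable (fun ω => stdError b₀ X Y βlim n ω i) P := fun i => by
    have e : ∀ ω, stdError b₀ X Y βlim n ω i =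
        inner ℝ (stdError b₀ X Y βlim n ω) (EuclideanSpace.single i (1 : ℝ)) := fun ω => by
      simp [EuclideanSpace.inner_single_right]
    simp_rw [e, inner_stdError]
    exact (((measurable_histSigma_invSqrt_V n _).mono (hM.histSigma_le n)
      le_rfl).aemeasurable.inner (hβ.sub (hM.measurable_beta n).aemeasurable)).const_mul _
  exact (by fun_prop : Measurable (WithLp.toLp 2 : (Fin d → ℝ) → Vec d)).comp_aemeasurable
    (aemeasurable_pi_iff.2 h)

theorem norm_setIntegral_charFun_sub_le (hM : IsOnlineModel P PX b₀ X Y C) {βlim : Ω → Vec d}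
    (hβ : ∀ᵐ ω ∂P, Tendsto (fun n => beta b₀ X Y n ω) atTop (𝓝 (βlim ω))) {n : ℕ}
    (hn : 1 ≤ n) (t : Vec d) {M : ℝ} (hM0 : 0 ≤ M) {B : Set Ω}
    (hB : MeasurableSet[histSigma b₀ X Y n] B)
    (hBM : ∀ ω ∈ B, ‖Matrix.toEuclideanCLM (𝕜 := ℝ) (invSqrt (V b₀ X Y n ω)) t‖ ≤ M) :
    ‖∫ ω in B, (charFun (condLaw P b₀ X Y (stdError b₀ X Y βlim n) n ω : Measure (Vec d)) t -
      (Real.exp (-fisher PX (beta b₀ X Y n ω)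
        (Matrix.toEuclideanCLM (𝕜 := ℝ) (invSqrt (V b₀ X Y n ω)) t) / 2) : ℂ)) ∂P‖ ≤
      cltConst C M / Real.sqrt n * P.real B := by
  have hle := hM.histSigma_le n
  have hlimm : AEMeasurable βlim P :=
    aemeasurable_of_tendsto_metrizable_ae atTop (fun k => (hM.measurable_beta k).aemeasurable) hβ
  have hZ := hM.aemeasurable_stdError hlimm n
  set Z := stdError b₀ X Y βlim n with hZdef
  set A : Ω → Vec d := fun ω => Matrix.toEuclideanCLM (𝕜 := ℝ) (invSqrt (V b₀ X Y n ω)) t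
  have hA : Measurable[histSigma b₀ X Y n] A := measurable_histSigma_invSqrt_V n t
  -- The direction is bounded by `M` only on `B`, whereas the central limit bound asks for it
  -- everywhere; hence the cut-off.
  have hT : Measurable[histSigma b₀ X Y n] (B.indicator A) := hA.indicator hB
  have hTM : ∀ ω, ‖B.indicator A ω‖ ≤ M := fun ω => by
    by_cases hω : ω ∈ B
    · simpa [hω] using hBM ω hω
    · simpa [hω] using hM0
  have hφ : Continuous fun z : Vec d => Complex.exp ((inner ℝ z t : ℝ) * Complex.I) := by
    fun_prop
  have hφi : Integrable (fun ω => Complex.exp ((inner ℝ (Z ω) t : ℝ) * Complex.I)) P :=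
    Integrable.of_bound (hφ.measurable.comp_aemeasurable hZ).aestronglyMeasurable 1
      (ae_of_all _ fun ω => (Complex.norm_exp_ofReal_mul_I _).le)
  have hcond := condExp_ae_eq_integral_condDistrib (hM.measurable_hist n) hZ
    hφ.stronglyMeasurable hφi
  have hchar : ∫ ω in B, charFun (condLaw P b₀ X Y Z n ω : Measure (Vec d)) t ∂P =
      ∫ ω in B, Complex.exp ((inner ℝ (Z ω) t : ℝ) * Complex.I) ∂P := by
    rw [← setIntegral_condExp hle hφi hB]
    refine integral_congr_ae (ae_restrict_of_ae ?_)
    filter_upwards [hcond] with ω hω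
    rw [hω, charFun_apply]
    rfl
  have hci : Integrable
      (fun ω => charFun (condLaw P b₀ X Y Z n ω : Measure (Vec d)) t) P := by
    refine (integrable_condExp (m := histSigma b₀ X Y n)
      (f := fun ω => Complex.exp ((inner ℝ (Z ω) t : ℝ) * Complex.I))).congr ?_
    filter_upwards [hcond] with ω hω
    rw [hω, charFun_apply]
    rfl
  have hgi : Integrable (fun ω => (Real.exp (-fisher PX (beta b₀ X Y n ω) (A ω) / 2) : ℂ)) P := by
    have h1 := (measurable_exp_fisher (PX := PX) n hA 1).mono hle le_rfl
    have h2 := Integrable.of_bound (μ := P) h1.aestronglyMeasurable 1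
      (ae_of_all _ fun ω => norm_exp_neg_fisher_le PX _ _ zero_le_one)
    simpa using h2
  have hmain := hM.norm_setIntegral_exp_sub_le hβ hn hT hM0 hTM hB
  rw [integral_sub hci.integrableOn hgi.integrableOn, hchar,
    ← integral_sub hφi.integrableOn hgi.integrableOn]
  refine (le_of_eq ?_).trans hmain
  congr 1
  refine setIntegral_congr_fun (hle _ hB) fun ω hω => ?_
  simp only [Set.indicator_of_mem hω, hZdef, inner_stdError]
  rfl

theorem stronglyMeasurable_charFun_condLaw (Z : Ω → Vec d) (n : ℕ) (t : Vec d) :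
    StronglyMeasurable[histSigma b₀ X Y n]
      fun ω => charFun (condLaw P b₀ X Y Z n ω : Measure (Vec d)) t := by
  have hφ : Continuous fun z : (Vec d × (Fin n → Vec d × Fin 2)) × Vec d =>
      Complex.exp ((inner ℝ z.2 t : ℝ) * Complex.I) := by
    fun_prop
  simp only [charFun_apply]
  exact stronglyMeasurable_integral_condDistrib (X := hist b₀ X Y n) (Y := Z) (μ := P)
    hφ.stronglyMeasurable

/-- The event that V_n^(-1/2) t is at most `M` in norm belongs to the history, so the integrated
bound may be localized to it and then turned into a pointwise one. -/
theorem ae_norm_charFun_sub_le (hM : IsOnlineModel P PX b₀ X Y C) {βlim : Ω → Vec d}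
    (hβ : ∀ᵐ ω ∂P, Tendsto (fun n => beta b₀ X Y n ω) atTop (𝓝 (βlim ω))) {n : ℕ}
    (hn : 1 ≤ n) (t : Vec d) {M : ℝ} (hM0 : 0 ≤ M) :
    ∀ᵐ ω ∂P, ‖Matrix.toEuclideanCLM (𝕜 := ℝ) (invSqrt (V b₀ X Y n ω)) t‖ ≤ M →
      ‖charFun (condLaw P b₀ X Y (stdError b₀ X Y βlim n) n ω : Measure (Vec d)) t -
        (Real.exp (-fisher PX (beta b₀ X Y n ω)
          (Matrix.toEuclideanCLM (𝕜 := ℝ) (invSqrt (V b₀ X Y n ω)) t) / 2) : ℂ)‖ ≤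
        2 * (cltConst C M / Real.sqrt n) := by
  have hle := hM.histSigma_le n
  set A : Ω → Vec d := fun ω => Matrix.toEuclideanCLM (𝕜 := ℝ) (invSqrt (V b₀ X Y n ω)) t
  have hA : Measurable[histSigma b₀ X Y n] A := measurable_histSigma_invSqrt_V n t
  have hS : MeasurableSet[histSigma b₀ X Y n] {ω | ‖A ω‖ ≤ M} :=
    (measurable_norm.comp hA) measurableSet_Iic
  set S : Set Ω := {ω | ‖A ω‖ ≤ M}
  set f : Ω → ℂ := fun ω =>
    charFun (condLaw P b₀ X Y (stdError b₀ X Y βlim n) n ω : Measure (Vec d)) t -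
      (Real.exp (-fisher PX (beta b₀ X Y n ω) (A ω) / 2) : ℂ)
  have hexp : Measurable[histSigma b₀ X Y n]
      fun ω => (Real.exp (-fisher PX (beta b₀ X Y n ω) (A ω) / 2) : ℂ) := by
    simpa using measurable_exp_fisher (PX := PX) n hA 1
  have hfm : StronglyMeasurable[histSigma b₀ X Y n] f :=
    (stronglyMeasurable_charFun_condLaw _ n t).sub hexp.stronglyMeasurable
  have hfi : Integrable f P := by
    refine Integrable.of_bound (hfm.mono hle).aestronglyMeasurable (1 + 1)
      (ae_of_all _ fun ω => (norm_sub_le _ _).trans (add_le_add (norm_charFun_le_one _) ?_))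
    simpa using norm_exp_neg_fisher_le PX (beta b₀ X Y n ω) (A ω) zero_le_one
  have h := ae_norm_le_of_forall_norm_setIntegral_le hle (hfm.indicator hS)
    (hfi.indicator (hle _ hS)) (c := cltConst C M / Real.sqrt n) fun B hB => by
      rw [setIntegral_indicator (hle _ hS)]
      refine (hM.norm_setIntegral_charFun_sub_le hβ hn t hM0 (hB.inter hS)
        fun ω hω => hω.2).trans ?_
      have := cltConst_nonneg hM.bound_nonneg hM0
      gcongr
      · simp
      · exact Set.inter_subset_left
  filter_upwards [h] with ω hω hAω
  rwa [Set.indicator_of_mem (show ω ∈ S from hAω)] at hω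

theorem continuous_fisher_apply {PX : Measure (Vec d)} [IsProbabilityMeasure PX]
    (hC : ∀ᵐ x ∂PX, ‖x‖ ≤ C) : Continuous fun p : Vec d × Vec d => fisher PX p.1 p.2 := by
  simp_rw [← inner_toEuclideanCLM_U hC]
  exact continuous_snd.inner (Continuous.comp (f := fun p : Vec d × Vec d => (U PX p.1, p.2))
    continuous_toEuclideanCLM_apply
    (((continuous_U hC).comp continuous_fst).prodMk continuous_snd))

/-- One null set for all t: the bound holds on a countable dense set and passes to limits by
continuity. The strict inequality makes the admissible set of t open, so dense points approach t
from within it. -/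
theorem ae_forall_norm_charFun_sub_le (hM : IsOnlineModel P PX b₀ X Y C) {βlim : Ω → Vec d}
    (hβ : ∀ᵐ ω ∂P, Tendsto (fun n => beta b₀ X Y n ω) atTop (𝓝 (βlim ω))) :
    ∀ᵐ ω ∂P, ∀ (n M : ℕ), 1 ≤ n → ∀ t : Vec d,
      ‖Matrix.toEuclideanCLM (𝕜 := ℝ) (invSqrt (V b₀ X Y n ω)) t‖ < M →
      ‖charFun (condLaw P b₀ X Y (stdError b₀ X Y βlim n) n ω : Measure (Vec d)) t -
        (Real.exp (-fisher PX (beta b₀ X Y n ω)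
          (Matrix.toEuclideanCLM (𝕜 := ℝ) (invSqrt (V b₀ X Y n ω)) t) / 2) : ℂ)‖ ≤
        2 * (cltConst C M / Real.sqrt n) := by
  obtain ⟨D, hDc, hDd⟩ := TopologicalSpace.exists_countable_dense (Vec d)
  have h : ∀ᵐ ω ∂P, ∀ (n M : ℕ), 1 ≤ n → ∀ t ∈ D,
      ‖Matrix.toEuclideanCLM (𝕜 := ℝ) (invSqrt (V b₀ X Y n ω)) t‖ ≤ M →
      ‖charFun (condLaw P b₀ X Y (stdError b₀ X Y βlim n) n ω : Measure (Vec d)) t -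
        (Real.exp (-fisher PX (beta b₀ X Y n ω)
          (Matrix.toEuclideanCLM (𝕜 := ℝ) (invSqrt (V b₀ X Y n ω)) t) / 2) : ℂ)‖ ≤
        2 * (cltConst C M / Real.sqrt n) := by
    rw [ae_all_iff]
    intro n
    rw [ae_all_iff]
    intro M
    rw [eventually_imp_distrib_left]
    intro hn
    rw [ae_ball_iff hDc]
    exact fun t _ => hM.ae_norm_charFun_sub_le hβ hn t M.cast_nonneg
  filter_upwards [h] with ω hω n M hn t ht
  set A := Matrix.toEuclideanCLM (𝕜 := ℝ) (invSqrt (V b₀ X Y n ω))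
  have hO : IsOpen {s : Vec d | ‖A s‖ < M} := isOpen_lt A.continuous.norm continuous_const
  have hcl : t ∈ closure ({s : Vec d | ‖A s‖ < M} ∩ D) := hDd.open_subset_closure_inter hO ht
  have hF : Continuous fun s : Vec d =>
      ‖charFun (condLaw P b₀ X Y (stdError b₀ X Y βlim n) n ω : Measure (Vec d)) s -
        (Real.exp (-fisher PX (beta b₀ X Y n ω) (A s) / 2) : ℂ)‖ := by
    refine (continuous_charFun.sub (Complex.continuous_ofReal.comp (Real.continuous_exp.comp
      (Continuous.div_const (Continuous.neg ?_) 2)))).norm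
    exact Continuous.comp (f := fun s => (beta b₀ X Y n ω, A s))
      (continuous_fisher_apply hM.feature_le) (by fun_prop)
  exact closure_minimal (fun s hs => hω n M hn s hs.2 (le_of_lt hs.1))
    (isClosed_le hF continuous_const) hcl

theorem ae_tendsto_condLaw (hM : IsOnlineModel P PX b₀ X Y C)
    (hnondeg : ∀ S : Submodule ℝ (Vec d), S ≠ ⊤ → PX (S : Set (Vec d)) < 1) {βlim : Ω → Vec d}
    (hβ : ∀ᵐ ω ∂P, Tendsto (fun n => beta b₀ X Y n ω) atTop (𝓝 (βlim ω))) :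
    ∀ᵐ ω ∂P, Tendsto (fun n => condLaw P b₀ X Y (stdError b₀ X Y βlim n) n ω) atTop
      (𝓝 (⟨stdGaussian (Vec d), inferInstance⟩ : ProbabilityMeasure (Vec d))) := by
  filter_upwards [hβ, hM.ae_tendsto_V hβ, hM.ae_forall_norm_charFun_sub_le hβ] with ω h1 h2 h3
  refine ProbabilityMeasure.tendsto_iff_tendsto_charFun.2 fun t => ?_
  have hU := posDef_U hM.feature_le hnondeg (βlim ω)
  have hA : Tendsto (fun n => Matrix.toEuclideanCLM (𝕜 := ℝ) (invSqrt (V b₀ X Y n ω)) t) atTop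
      (𝓝 (Matrix.toEuclideanCLM (𝕜 := ℝ) (invSqrt (U PX (βlim ω))) t)) :=
    Tendsto.comp (f := fun n => (invSqrt (V b₀ X Y n ω), t))
      (continuous_toEuclideanCLM_apply.tendsto (invSqrt (U PX (βlim ω)), t))
      ((tendsto_invSqrt (fun n => posSemidef_V b₀ X Y n ω) hU h2).prodMk_nhds tendsto_const_nhds)
  have hfish : Tendsto (fun n => fisher PX (beta b₀ X Y n ω)
      (Matrix.toEuclideanCLM (𝕜 := ℝ) (invSqrt (V b₀ X Y n ω)) t)) atTop (𝓝 (‖t‖ ^ 2)) := by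
    have := Tendsto.comp (f := fun n => (beta b₀ X Y n ω,
        Matrix.toEuclideanCLM (𝕜 := ℝ) (invSqrt (V b₀ X Y n ω)) t))
      ((continuous_fisher_apply hM.feature_le).tendsto
        (βlim ω, Matrix.toEuclideanCLM (𝕜 := ℝ) (invSqrt (U PX (βlim ω))) t))
      (h1.prodMk_nhds hA)
    rwa [← inner_toEuclideanCLM_U hM.feature_le, inner_invSqrt_self hU] at this
  have hexp : Tendsto (fun n => (Real.exp (-fisher PX (beta b₀ X Y n ω)
      (Matrix.toEuclideanCLM (𝕜 := ℝ) (invSqrt (V b₀ X Y n ω)) t) / 2) : ℂ)) atTop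
      (𝓝 (Real.exp (-‖t‖ ^ 2 / 2) : ℂ)) := by
    have hc : Continuous fun x : ℝ => (Real.exp (-x / 2) : ℂ) := by fun_prop
    exact (hc.tendsto _).comp hfish
  -- `M` depends on ω and t, which is harmless because the bound holds for all natural `M` off a
  -- single null set.
  obtain ⟨M, hMA⟩ := exists_nat_gt
    ‖Matrix.toEuclideanCLM (𝕜 := ℝ) (invSqrt (U PX (βlim ω))) t‖
  have hbound : ∀ᶠ n : ℕ in atTop,
      ‖charFun (condLaw P b₀ X Y (stdError b₀ X Y βlim n) n ω : Measure (Vec d)) t -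
        (Real.exp (-fisher PX (beta b₀ X Y n ω)
          (Matrix.toEuclideanCLM (𝕜 := ℝ) (invSqrt (V b₀ X Y n ω)) t) / 2) : ℂ)‖ ≤
        2 * (cltConst C M / Real.sqrt n) := by
    filter_upwards [hA.norm.eventually_lt_const hMA, eventually_ge_atTop 1] with n h4 h5
    exact h3 n M h5 t h4
  have hzero : Tendsto (fun n : ℕ => 2 * (cltConst C M / Real.sqrt n)) atTop (𝓝 0) := by
    have := (tendsto_const_nhds (x := cltConst C M)).div_atTop
      (Real.tendsto_sqrt_atTop.comp tendsto_natCast_atTop_atTop)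
    simpa using this.const_mul 2
  have hsum := (squeeze_zero_norm' hbound hzero).add hexp
  simp only [sub_add_cancel, zero_add] at hsum
  have e_gauss : charFun (stdGaussian (Vec d)) t = (Real.exp (-‖t‖ ^ 2 / 2) : ℂ) := by
    rw [charFun_stdGaussian]
    push_cast
    rfl
  rw [← e_gauss] at hsum
  exact hsum

end IsOnlineModel

end OnlineLogistic

theorem mainTheorem7 {d : ℕ} {Ω : Type*} [MeasurableSpace Ω]
    (P : MeasureTheory.Measure Ω) [MeasureTheory.IsProbabilityMeasure P]
    (PX : MeasureTheory.Measure (OnlineLogistic.Vec d)) [MeasureTheory.IsProbabilityMeasure PX]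
    (b₀ : Ω → OnlineLogistic.Vec d) (X : ℕ → Ω → OnlineLogistic.Vec d) (Y : ℕ → Ω → Fin 2)
    (hb₀ : Measurable b₀) (hX : ∀ n, 1 ≤ n → Measurable (X n)) (hY : ∀ n, 1 ≤ n → Measurable (Y n))
    (hrule : OnlineLogistic.IsPredictiveRule P PX b₀ X Y)
    (hb₀2 : Integrable (fun ω => ‖b₀ ω‖ ^ 2) P)
    (hbdd : Bornology.IsBounded PX.support)
    (hnondeg : ∀ S : Submodule ℝ (OnlineLogistic.Vec d), S ≠ ⊤ →
      PX (S : Set (OnlineLogistic.Vec d)) < 1) :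
    (∃ βlim : Ω → OnlineLogistic.Vec d, Measurable βlim ∧
      ∀ᵐ ω ∂P, Tendsto (fun n => OnlineLogistic.beta b₀ X Y n ω) atTop (𝓝 (βlim ω))) ∧
    ∀ βlim : Ω → OnlineLogistic.Vec d,
      (∀ᵐ ω ∂P, Tendsto (fun n => OnlineLogistic.beta b₀ X Y n ω) atTop (𝓝 (βlim ω))) →
      (∀ᵐ ω ∂P, Tendsto (fun n => OnlineLogistic.V b₀ X Y n ω) atTop
        (𝓝 (OnlineLogistic.U PX (βlim ω)))) ∧
      (∀ᵐ ω ∂P, Tendsto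
        (fun n => OnlineLogistic.condLaw P b₀ X Y (OnlineLogistic.stdError b₀ X Y βlim n) n ω)
        atTop
        (𝓝 (⟨stdGaussian (OnlineLogistic.Vec d), inferInstance⟩ :
          ProbabilityMeasure (OnlineLogistic.Vec d)))) := by
  obtain ⟨C, hC0, hC⟩ := hbdd.exists_pos_norm_le
  have hM : OnlineLogistic.IsOnlineModel P PX b₀ X Y C :=
    { meas_init := hb₀
      meas_feature := hX
      meas_label := hY
      rule := hrule
      bound_nonneg := hC0.le
      feature_le := by
        -- The support carries full mass, so its boundedness bounds the features almost surely.
        filter_upwards [PX.support_mem_ae] with x hx using hC x hx }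
  exact ⟨measurable_limit_of_tendsto_metrizable_ae
      (fun n => (hM.measurable_beta n).aemeasurable) hM.ae_exists_tendsto_beta,
    fun _ hβ => ⟨hM.ae_tendsto_V hβ, hM.ae_tendsto_condLaw hnondeg hβ⟩⟩
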